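/- An MV-algebra is a structure $(A,\oplus,{}^*,0)$ such that $(A,\oplus,0)$ is an Abelian monoid and, for all $x,y\in A$, $x^{**}=x$, $0^*\oplus x=0^*$ and $(x^*\oplus y)^*\oplus y=(y^*\oplus x)^*\oplus x$. Put $1=0^*$, $x\odot y=(x^*\oplus y^*)^*$, $x\vee y=x\oplus(y\odot x^*)$, $x\wedge y=(x^*\vee y^*)^*$, and $x\le y$ iff $x\vee y=y$. Let $[0,1]_Q=[0,1]\cap\mathbb Q$, an MV-algebra under $x\oplus y=\min(1,x+y)$ and $x^*=1-x$. A DMV-algebra is an MV-algebra with unary operations $x\mapsto qx$, $q\in[0,1]_Q$, such that $q(x\odot y^*)=(qx)\odot(qy)^*$, $(r\odot q^*)x=(rx)\odot(qx)^*$, $r(qx)=(rq)x$ and $1x=x$. Homomorphisms preserve all operations. An MV-algebra is semisimple if its homomorphisms into the real unit interval $[0,1]$ separate its points; a DMV-algebra is semisimple if its MV-reduct is. The principal ideal generated by $a$ is $(a]=\{x : x\le na \text{ for some } n\in\mathbb N\}$, where $0a=0$ and $(n+1)a=na\oplus a$. Let $MV_n$ and $DMV_n$ be the free MV-algebra and the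 free DMV-algebra on $n$ generators; an MV-algebra (DMV-algebra) is finitely presented if it is isomorphic to $MV_n/(a]$ (to $DMV_n/(a]$) for some $n\in\mathbb N$ and some $a$. A bimorphism $\beta:A\times B\to C$ of MV-algebras is a map with $\beta(1,1)=1$ and $\beta(a,0)=\beta(0,b)=0$ that preserves $\vee$ and $\wedge$ in each variable separately and satisfies: if $b\odot b'=0$ then $\beta(a,b)\odot\beta(a,b')=0$ and $\beta(a,b\oplus b')=\beta(a,b)\oplus\beta(a,b')$, and likewise in the first variable. The semisimple tensor product $A\otimes B$ is the semisimple MV-algebra with a universal bimorphism $(a,b)\mapsto a\otimes b$ among bimorphisms from $A\times B$ into semisimple MV-algebras. For a semisimple MV-algebra $A$ let $\mathcal D_\otimes(A)=[0,1]_Q\otimes A$, which is a semisimple DMV-algebra with $q(p\otimes a)=(qp)\otimes a$; let $\iota_A(a)=1\otimes a$; and for a homomorphism $f:A\to B$ let $\mathcal D_\otimes(f)$ be the unique DMV-homomorphism with $\mathcal D_\otimes(f)\circ\iota_A=\iota_B\circ f$. This defines a functor $\mathcal D_\otimes$ from semisimple MV-algebras to semisimple DMV-algebras. **Theorem.** Finitely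 presented MV-algebras are semisimple, $\mathcal D_\otimes$ sends finitely presented MV-algebras to finitely presented DMV-algebras, and the resulting restricted functor $$\mathcal D_\otimes^{\mathbf{fp}}:\mathbf{MV_{fp}}\to\mathbf{DMV_{fp}}$$ between the full subcategories of finitely presented algebras is faithful and essentially surjective. Moreover, for every $n\in\mathbb N$, every principal ideal of $DMV_n$ is generated by the image of an element of $MV_n$ under the canonical homomorphism $MV_n\to DMV_n$ that sends generators to generators. -/

import Mathlib

open CategoryTheory

universe u v w

namespace MV

/-! ### MV-algebras -/

/-- MV-algebras, as algebras of type `(2,1,0)`. -/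
class MVAlgebra (A : Type u) where
  oplus : A → A → A
  neg : A → A
  zero : A
  oplus_assoc : ∀ x y z, oplus (oplus x y) z = oplus x (oplus y z)
  oplus_comm : ∀ x y, oplus x y = oplus y x
  oplus_zero : ∀ x, oplus x zero = x
  neg_neg : ∀ x, neg (neg x) = x
  neg_zero_oplus : ∀ x, oplus (neg zero) x = neg zero
  luk : ∀ x y, oplus (neg (oplus (neg x) y)) y = oplus (neg (oplus (neg y) x)) x

open MVAlgebra

section Operations

variable {A : Type u} [MVAlgebra A]

/-- `1 = 0*` -/
def one : A := neg zero

/-- `x ⊙ y = (x* ⊕ y*)*` -/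
def odot (x y : A) : A := neg (oplus (neg x) (neg y))

/-- `x ∨ y = x ⊕ (y ⊙ x*)` -/
def sup (x y : A) : A := oplus x (odot y (neg x))

/-- `x ∧ y = (x* ∨ y*)*` -/
def inf (x y : A) : A := neg (sup (neg x) (neg y))

/-- The lattice order: `x ≤ y` iff `x ∨ y = y`. -/
def le (x y : A) : Prop := sup x y = y

/-- `0 x = 0`, `(n+1) x = n x ⊕ x` -/
def nmul : ℕ → A → A
  | 0, _ => zero
  | n + 1, x => oplus (nmul n x) x

/-- The principal ideal `(a] = {x | x ≤ n a for some n}`. -/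
def principalIdeal (a : A) : Set A := {x | ∃ n : ℕ, le x (nmul n a)}

end Operations

/-- Homomorphisms of MV-algebras. -/
@[ext]
structure MVHom (A : Type u) (B : Type v) [MVAlgebra A] [MVAlgebra B] where
  toFun : A → B
  map_oplus : ∀ x y, toFun (oplus x y) = oplus (toFun x) (toFun y)
  map_neg : ∀ x, toFun (neg x) = neg (toFun x)
  map_zero : toFun zero = zero

instance (A : Type u) (B : Type v) [MVAlgebra A] [MVAlgebra B] :
    CoeFun (MVHom A B) (fun _ => A → B) := ⟨MVHom.toFun⟩

namespace MVHom

variable {A : Type u} {B : Type v} {C : Type w} [MVAlgebra A] [MVAlgebra B] [MVAlgebra C]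

def id (A : Type u) [MVAlgebra A] : MVHom A A := ⟨fun x => x, fun _ _ => rfl, fun _ => rfl, rfl⟩

def comp (g : MVHom B C) (f : MVHom A B) : MVHom A C where
  toFun x := g (f x)
  map_oplus x y := by rw [f.map_oplus, g.map_oplus]
  map_neg x := by rw [f.map_neg, g.map_neg]
  map_zero := by rw [f.map_zero, g.map_zero]

theorem map_one (f : MVHom A B) : f one = one := by
  simp only [one, f.map_neg, f.map_zero]

theorem map_odot (f : MVHom A B) (x y : A) : f (odot x y) = odot (f x) (f y) := by
  simp only [odot, f.map_neg, f.map_oplus]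

theorem map_sup (f : MVHom A B) (x y : A) : f (sup x y) = sup (f x) (f y) := by
  simp only [sup, f.map_neg, f.map_oplus, f.map_odot]

theorem map_inf (f : MVHom A B) (x y : A) : f (inf x y) = inf (f x) (f y) := by
  simp only [inf, f.map_neg, f.map_sup]

end MVHom

/-! ### The standard algebras `[0,1]` and `[0,1] ∩ ℚ` -/

section Standard

variable {K : Type u} [Field K] [LinearOrder K] [IsStrictOrderedRing K]

/-- The unit interval of an ordered field, with `x ⊕ y = min (1, x + y)` and `x* = 1 - x`. -/
instance instMVIcc : MVAlgebra (Set.Icc (0 : K) 1) where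
  oplus x y := ⟨min 1 (x.1 + y.1), le_min zero_le_one (add_nonneg x.2.1 y.2.1), min_le_left _ _⟩
  neg x := ⟨1 - x.1, sub_nonneg.2 x.2.2, sub_le_self _ x.2.1⟩
  zero := ⟨0, le_refl _, zero_le_one⟩
  oplus_assoc := by
    rintro ⟨x, hx⟩ ⟨y, hy⟩ ⟨z, hz⟩
    obtain ⟨h1, h2⟩ := hx
    obtain ⟨h3, h4⟩ := hy
    obtain ⟨h5, h6⟩ := hz
    refine Subtype.ext ?_
    simp only
    grind
  oplus_comm x y := Subtype.ext (by simp only [add_comm])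
  oplus_zero x := Subtype.ext (by simpa using x.2.2)
  neg_neg x := Subtype.ext (by simp)
  neg_zero_oplus x := Subtype.ext (by simpa using x.2.1)
  luk := by
    rintro ⟨x, hx⟩ ⟨y, hy⟩
    obtain ⟨h1, h2⟩ := hx
    obtain ⟨h3, h4⟩ := hy
    refine Subtype.ext ?_
    simp only
    grind

theorem coe_oplus (x y : Set.Icc (0 : K) 1) : (oplus x y).1 = min 1 (x.1 + y.1) := rfl

theorem coe_neg (x : Set.Icc (0 : K) 1) : (neg x).1 = 1 - x.1 := rfl

theorem coe_zero : (zero : Set.Icc (0 : K) 1).1 = 0 := rfl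

theorem coe_one : (one : Set.Icc (0 : K) 1).1 = 1 := by
  simp only [one, coe_neg, coe_zero, sub_zero]

theorem coe_odot (x y : Set.Icc (0 : K) 1) : (odot x y).1 = max 0 (x.1 + y.1 - 1) := by
  simp only [odot, coe_neg, coe_oplus]
  grind

theorem coe_sup (x y : Set.Icc (0 : K) 1) : (sup x y).1 = max x.1 y.1 := by
  have h1 := x.2.2
  have h2 := y.2.2
  simp only [sup, coe_neg, coe_oplus, coe_odot]
  grind

theorem coe_inf (x y : Set.Icc (0 : K) 1) : (inf x y).1 = min x.1 y.1 := by
  simp only [inf, coe_neg, coe_sup]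
  grind

end Standard

/-- The standard MV-algebra `[0,1]`. -/
abbrev UnitR : Type := Set.Icc (0 : ℝ) 1

/-- The MV-algebra of rationals in `[0,1]`. -/
abbrev UnitQ : Type := Set.Icc (0 : ℚ) 1

/-! ### DMV-algebras -/

/-- DMV-algebras: MV-algebras with a scalar multiplication by rationals in `[0,1]`. -/
class DMVAlgebra (A : Type u) extends MVAlgebra A where
  qmul : UnitQ → A → A
  qmul_odot_neg : ∀ (q : UnitQ) (x y : A),
    qmul q (odot x (neg y)) = odot (qmul q x) (neg (qmul q y))
  odot_neg_qmul : ∀ (r q : UnitQ) (x : A),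
    qmul (odot r (MVAlgebra.neg q)) x = odot (qmul r x) (neg (qmul q x))
  qmul_qmul : ∀ (r q : UnitQ) (x : A), qmul r (qmul q x) = qmul (r * q) x
  one_qmul : ∀ x : A, qmul 1 x = x

open DMVAlgebra

/-- Homomorphisms of DMV-algebras. -/
@[ext]
structure DMVHom (A : Type u) (B : Type v) [DMVAlgebra A] [DMVAlgebra B]
    extends MVHom A B where
  map_qmul : ∀ (q : UnitQ) (x : A), toFun (qmul q x) = qmul q (toFun x)

instance (A : Type u) (B : Type v) [DMVAlgebra A] [DMVAlgebra B] :
    CoeFun (DMVHom A B) (fun _ => A → B) := ⟨fun f => f.toFun⟩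

namespace DMVHom

variable {A : Type u} {B : Type v} {C : Type w} [DMVAlgebra A] [DMVAlgebra B] [DMVAlgebra C]

def id (A : Type u) [DMVAlgebra A] : DMVHom A A := ⟨MVHom.id A, fun _ _ => rfl⟩

def comp (g : DMVHom B C) (f : DMVHom A B) : DMVHom A C where
  toMVHom := g.toMVHom.comp f.toMVHom
  map_qmul q x := by
    change g (f (qmul q x)) = qmul q (g (f x))
    rw [f.map_qmul, g.map_qmul]

end DMVHom

/-! ### Free algebras: terms in `n` variables modulo the equations -/

/-- MV-terms in the variables `x_0, …, x_{n-1}`. -/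
inductive MVTerm (n : ℕ) : Type
  | var : Fin n → MVTerm n
  | zero : MVTerm n
  | neg : MVTerm n → MVTerm n
  | oplus : MVTerm n → MVTerm n → MVTerm n

/-- Two terms are related when the MV-algebra axioms prove them equal. -/
inductive MVTerm.Rel {n : ℕ} : MVTerm n → MVTerm n → Prop
  | refl (s : MVTerm n) : Rel s s
  | symm {s t : MVTerm n} : Rel s t → Rel t s
  | trans {s t r : MVTerm n} : Rel s t → Rel t r → Rel s r
  | neg {s t : MVTerm n} : Rel s t → Rel s.neg t.neg
  | oplus {s t s' t' : MVTerm n} : Rel s t → Rel s' t' → Rel (s.oplus s') (t.oplus t')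
  | oplus_assoc (s t r : MVTerm n) : Rel ((s.oplus t).oplus r) (s.oplus (t.oplus r))
  | oplus_comm (s t : MVTerm n) : Rel (s.oplus t) (t.oplus s)
  | oplus_zero (s : MVTerm n) : Rel (s.oplus MVTerm.zero) s
  | neg_neg (s : MVTerm n) : Rel s.neg.neg s
  | neg_zero_oplus (s : MVTerm n) : Rel (MVTerm.zero.neg.oplus s) MVTerm.zero.neg
  | luk (s t : MVTerm n) : Rel ((s.neg.oplus t).neg.oplus t) ((t.neg.oplus s).neg.oplus s)

def MVTerm.setoid (n : ℕ) : Setoid (MVTerm n) :=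
  ⟨MVTerm.Rel, MVTerm.Rel.refl, MVTerm.Rel.symm, MVTerm.Rel.trans⟩

/-- The free MV-algebra `MV_n` on `n` generators. -/
def FreeMV (n : ℕ) : Type := Quotient (MVTerm.setoid n)

instance (n : ℕ) : MVAlgebra (FreeMV n) where
  oplus := Quotient.map₂ MVTerm.oplus (fun _ _ h _ _ h' => MVTerm.Rel.oplus h h')
  neg := Quotient.map MVTerm.neg (fun _ _ h => MVTerm.Rel.neg h)
  zero := Quotient.mk _ MVTerm.zero
  oplus_assoc := by
    rintro ⟨x⟩ ⟨y⟩ ⟨z⟩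
    exact Quotient.sound (MVTerm.Rel.oplus_assoc x y z)
  oplus_comm := by
    rintro ⟨x⟩ ⟨y⟩
    exact Quotient.sound (MVTerm.Rel.oplus_comm x y)
  oplus_zero := by
    rintro ⟨x⟩
    exact Quotient.sound (MVTerm.Rel.oplus_zero x)
  neg_neg := by
    rintro ⟨x⟩
    exact Quotient.sound (MVTerm.Rel.neg_neg x)
  neg_zero_oplus := by
    rintro ⟨x⟩
    exact Quotient.sound (MVTerm.Rel.neg_zero_oplus x)
  luk := by
    rintro ⟨x⟩ ⟨y⟩
    exact Quotient.sound (MVTerm.Rel.luk x y)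

/-- The free generators of `MV_n`. -/
def FreeMV.var {n : ℕ} (i : Fin n) : FreeMV n := Quotient.mk _ (MVTerm.var i)

/-- The value of a term in an MV-algebra. -/
def MVTerm.eval {n : ℕ} {A : Type u} [MVAlgebra A] (g : Fin n → A) : MVTerm n → A
  | .var i => g i
  | .zero => MVAlgebra.zero
  | .neg s => MVAlgebra.neg (s.eval g)
  | .oplus s t => MVAlgebra.oplus (s.eval g) (t.eval g)

theorem MVTerm.eval_eq {n : ℕ} {A : Type u} [MVAlgebra A] (g : Fin n → A) {s t : MVTerm n}
    (h : MVTerm.Rel s t) : s.eval g = t.eval g := by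
  induction h with
  | refl s => rfl
  | symm _ ih => exact ih.symm
  | trans _ _ ih ih' => exact ih.trans ih'
  | neg _ ih => simp only [MVTerm.eval, ih]
  | oplus _ _ ih ih' => simp only [MVTerm.eval, ih, ih']
  | oplus_assoc s t r => exact MVAlgebra.oplus_assoc _ _ _
  | oplus_comm s t => exact MVAlgebra.oplus_comm _ _
  | oplus_zero s => exact MVAlgebra.oplus_zero _
  | neg_neg s => exact MVAlgebra.neg_neg _
  | neg_zero_oplus s => exact MVAlgebra.neg_zero_oplus _
  | luk s t => exact MVAlgebra.luk _ _

/-- The homomorphism from `MV_n` extending a map on the generators. -/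
def FreeMV.lift {n : ℕ} {A : Type u} [MVAlgebra A] (g : Fin n → A) : MVHom (FreeMV n) A where
  toFun := Quotient.lift (MVTerm.eval g) (fun _ _ h => MVTerm.eval_eq g h)
  map_oplus := by
    rintro ⟨x⟩ ⟨y⟩
    rfl
  map_neg := by
    rintro ⟨x⟩
    rfl
  map_zero := rfl

theorem FreeMV.lift_var {n : ℕ} {A : Type u} [MVAlgebra A] (g : Fin n → A) (i : Fin n) :
    FreeMV.lift g (FreeMV.var i) = g i := rfl

theorem FreeMV.lift_unique {n : ℕ} {A : Type u} [MVAlgebra A] (g : Fin n → A)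
    (f : MVHom (FreeMV n) A) (hf : ∀ i, f (FreeMV.var i) = g i) : f = FreeMV.lift g := by
  refine MVHom.ext (funext ?_)
  rintro ⟨x⟩
  induction x with
  | var i => exact hf i
  | zero => exact f.map_zero
  | neg s ih => exact (f.map_neg _).trans (congrArg MVAlgebra.neg ih)
  | oplus s t ih ih' => exact (f.map_oplus _ _).trans (congrArg₂ MVAlgebra.oplus ih ih')

/-- DMV-terms in the variables `x_0, …, x_{n-1}`. -/
inductive DMVTerm (n : ℕ) : Type
  | var : Fin n → DMVTerm n
  | zero : DMVTerm n
  | neg : DMVTerm n → DMVTerm n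
  | oplus : DMVTerm n → DMVTerm n → DMVTerm n
  | qmul : UnitQ → DMVTerm n → DMVTerm n

/-- The term `s ⊙ t*`, that is `(s* ⊕ t**)*`. -/
def DMVTerm.diff {n : ℕ} (s t : DMVTerm n) : DMVTerm n := (s.neg.oplus t.neg.neg).neg

/-- Two terms are related when the DMV-algebra axioms prove them equal. -/
inductive DMVTerm.Rel {n : ℕ} : DMVTerm n → DMVTerm n → Prop
  | refl (s : DMVTerm n) : Rel s s
  | symm {s t : DMVTerm n} : Rel s t → Rel t s
  | trans {s t r : DMVTerm n} : Rel s t → Rel t r → Rel s r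
  | neg {s t : DMVTerm n} : Rel s t → Rel s.neg t.neg
  | oplus {s t s' t' : DMVTerm n} : Rel s t → Rel s' t' → Rel (s.oplus s') (t.oplus t')
  | qmul (q : UnitQ) {s t : DMVTerm n} : Rel s t → Rel (s.qmul q) (t.qmul q)
  | oplus_assoc (s t r : DMVTerm n) : Rel ((s.oplus t).oplus r) (s.oplus (t.oplus r))
  | oplus_comm (s t : DMVTerm n) : Rel (s.oplus t) (t.oplus s)
  | oplus_zero (s : DMVTerm n) : Rel (s.oplus DMVTerm.zero) s
  | neg_neg (s : DMVTerm n) : Rel s.neg.neg s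
  | neg_zero_oplus (s : DMVTerm n) : Rel (DMVTerm.zero.neg.oplus s) DMVTerm.zero.neg
  | luk (s t : DMVTerm n) : Rel ((s.neg.oplus t).neg.oplus t) ((t.neg.oplus s).neg.oplus s)
  | qmul_odot_neg (q : UnitQ) (s t : DMVTerm n) : Rel ((s.diff t).qmul q) ((s.qmul q).diff (t.qmul q))
  | odot_neg_qmul (r q : UnitQ) (s : DMVTerm n) :
      Rel (s.qmul (odot r (MVAlgebra.neg q))) ((s.qmul r).diff (s.qmul q))
  | qmul_qmul (r q : UnitQ) (s : DMVTerm n) : Rel ((s.qmul q).qmul r) (s.qmul (r * q))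
  | one_qmul (s : DMVTerm n) : Rel (s.qmul 1) s

def DMVTerm.setoid (n : ℕ) : Setoid (DMVTerm n) :=
  ⟨DMVTerm.Rel, DMVTerm.Rel.refl, DMVTerm.Rel.symm, DMVTerm.Rel.trans⟩

/-- The free DMV-algebra `DMV_n` on `n` generators. -/
def FreeDMV (n : ℕ) : Type := Quotient (DMVTerm.setoid n)

instance (n : ℕ) : DMVAlgebra (FreeDMV n) where
  oplus := Quotient.map₂ DMVTerm.oplus (fun _ _ h _ _ h' => DMVTerm.Rel.oplus h h')
  neg := Quotient.map DMVTerm.neg (fun _ _ h => DMVTerm.Rel.neg h)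
  zero := Quotient.mk _ DMVTerm.zero
  qmul q := Quotient.map (DMVTerm.qmul q) (fun _ _ h => DMVTerm.Rel.qmul q h)
  oplus_assoc := by
    rintro ⟨x⟩ ⟨y⟩ ⟨z⟩
    exact Quotient.sound (DMVTerm.Rel.oplus_assoc x y z)
  oplus_comm := by
    rintro ⟨x⟩ ⟨y⟩
    exact Quotient.sound (DMVTerm.Rel.oplus_comm x y)
  oplus_zero := by
    rintro ⟨x⟩
    exact Quotient.sound (DMVTerm.Rel.oplus_zero x)
  neg_neg := by
    rintro ⟨x⟩
    exact Quotient.sound (DMVTerm.Rel.neg_neg x)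
  neg_zero_oplus := by
    rintro ⟨x⟩
    exact Quotient.sound (DMVTerm.Rel.neg_zero_oplus x)
  luk := by
    rintro ⟨x⟩ ⟨y⟩
    exact Quotient.sound (DMVTerm.Rel.luk x y)
  qmul_odot_neg := by
    rintro q ⟨x⟩ ⟨y⟩
    exact Quotient.sound (DMVTerm.Rel.qmul_odot_neg q x y)
  odot_neg_qmul := by
    rintro r q ⟨x⟩
    exact Quotient.sound (DMVTerm.Rel.odot_neg_qmul r q x)
  qmul_qmul := by
    rintro r q ⟨x⟩
    exact Quotient.sound (DMVTerm.Rel.qmul_qmul r q x)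
  one_qmul := by
    rintro ⟨x⟩
    exact Quotient.sound (DMVTerm.Rel.one_qmul x)

/-- The free generators of `DMV_n`. -/
def FreeDMV.var {n : ℕ} (i : Fin n) : FreeDMV n := Quotient.mk _ (DMVTerm.var i)

/-- The value of a term in a DMV-algebra. -/
def DMVTerm.eval {n : ℕ} {A : Type u} [DMVAlgebra A] (g : Fin n → A) : DMVTerm n → A
  | .var i => g i
  | .zero => MVAlgebra.zero
  | .neg s => MVAlgebra.neg (s.eval g)
  | .oplus s t => MVAlgebra.oplus (s.eval g) (t.eval g)
  | .qmul q s => DMVAlgebra.qmul q (s.eval g)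

theorem DMVTerm.eval_eq {n : ℕ} {A : Type u} [DMVAlgebra A] (g : Fin n → A) {s t : DMVTerm n}
    (h : DMVTerm.Rel s t) : s.eval g = t.eval g := by
  induction h with
  | refl s => rfl
  | symm _ ih => exact ih.symm
  | trans _ _ ih ih' => exact ih.trans ih'
  | neg _ ih => simp only [DMVTerm.eval, ih]
  | oplus _ _ ih ih' => simp only [DMVTerm.eval, ih, ih']
  | qmul q _ ih => simp only [DMVTerm.eval, ih]
  | oplus_assoc s t r => exact MVAlgebra.oplus_assoc _ _ _
  | oplus_comm s t => exact MVAlgebra.oplus_comm _ _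
  | oplus_zero s => exact MVAlgebra.oplus_zero _
  | neg_neg s => exact MVAlgebra.neg_neg _
  | neg_zero_oplus s => exact MVAlgebra.neg_zero_oplus _
  | luk s t => exact MVAlgebra.luk _ _
  | qmul_odot_neg q s t => exact DMVAlgebra.qmul_odot_neg _ _ _
  | odot_neg_qmul r q s => exact DMVAlgebra.odot_neg_qmul _ _ _
  | qmul_qmul r q s => exact DMVAlgebra.qmul_qmul _ _ _
  | one_qmul s => exact DMVAlgebra.one_qmul _

/-- The homomorphism from `DMV_n` extending a map on the generators. -/
def FreeDMV.lift {n : ℕ} {A : Type u} [DMVAlgebra A] (g : Fin n → A) :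
    DMVHom (FreeDMV n) A where
  toFun := Quotient.lift (DMVTerm.eval g) (fun _ _ h => DMVTerm.eval_eq g h)
  map_oplus := by
    rintro ⟨x⟩ ⟨y⟩
    rfl
  map_neg := by
    rintro ⟨x⟩
    rfl
  map_zero := rfl
  map_qmul := by
    rintro q ⟨x⟩
    rfl

theorem FreeDMV.lift_var {n : ℕ} {A : Type u} [DMVAlgebra A] (g : Fin n → A) (i : Fin n) :
    FreeDMV.lift g (FreeDMV.var i) = g i := rfl

theorem FreeDMV.lift_unique {n : ℕ} {A : Type u} [DMVAlgebra A] (g : Fin n → A)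
    (f : DMVHom (FreeDMV n) A) (hf : ∀ i, f (FreeDMV.var i) = g i) : f = FreeDMV.lift g := by
  refine DMVHom.ext (funext ?_)
  rintro ⟨x⟩
  induction x with
  | var i => exact hf i
  | zero => exact f.map_zero
  | neg s ih => exact (f.map_neg _).trans (congrArg MVAlgebra.neg ih)
  | oplus s t ih ih' => exact (f.map_oplus _ _).trans (congrArg₂ MVAlgebra.oplus ih ih')
  | qmul q s ih => exact (f.map_qmul _ _).trans (congrArg (DMVAlgebra.qmul q) ih)

/-- The canonical MV-homomorphism `MV_n → DMV_n` sending generators to generators. -/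
def freeIncl (n : ℕ) : MVHom (FreeMV n) (FreeDMV n) := FreeMV.lift FreeDMV.var

/-! ### Finitely presented and semisimple algebras -/

/-- `A` is finitely presented: `A ≅ MV_n / (a]` for some `n` and `a`, i.e. `A` is the image of a
surjective homomorphism from `MV_n` whose kernel is the principal ideal `(a]`. -/
def FinPresMV (A : Type u) [MVAlgebra A] : Prop :=
  ∃ (n : ℕ) (a : FreeMV n) (π : MVHom (FreeMV n) A),
    Function.Surjective π ∧ {x | π x = zero} = principalIdeal a

/-- `A` is finitely presented: `A ≅ DMV_n / (a]` for some `n` and `a`. -/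
def FinPresDMV (A : Type u) [DMVAlgebra A] : Prop :=
  ∃ (n : ℕ) (a : FreeDMV n) (π : DMVHom (FreeDMV n) A),
    Function.Surjective π ∧ {x | π x = zero} = principalIdeal a

/-- `A` is semisimple: a subdirect product of subalgebras of `[0,1]`, i.e. the homomorphisms into
`[0,1]` separate its elements. -/
def Semisimple (A : Type u) [MVAlgebra A] : Prop :=
  ∀ x y : A, (∀ φ : MVHom A UnitR, φ x = φ y) → x = y

/-! ### The semisimple tensor product -/

/-- Bimorphisms of MV-algebras. -/
@[ext]
structure Bimorphism (A : Type u) (B : Type v) (C : Type w)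
    [MVAlgebra A] [MVAlgebra B] [MVAlgebra C] where
  toFun : A → B → C
  map_one_one : toFun one one = one
  map_zero_left : ∀ b, toFun zero b = zero
  map_zero_right : ∀ a, toFun a zero = zero
  map_sup_left : ∀ a a' b, toFun (sup a a') b = sup (toFun a b) (toFun a' b)
  map_inf_left : ∀ a a' b, toFun (inf a a') b = inf (toFun a b) (toFun a' b)
  map_sup_right : ∀ a b b', toFun a (sup b b') = sup (toFun a b) (toFun a b')
  map_inf_right : ∀ a b b', toFun a (inf b b') = inf (toFun a b) (toFun a b')
  odot_left : ∀ a a' b, odot a a' = zero → odot (toFun a b) (toFun a' b) = zero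
  oplus_left : ∀ a a' b, odot a a' = zero →
    toFun (oplus a a') b = oplus (toFun a b) (toFun a' b)
  odot_right : ∀ a b b', odot b b' = zero → odot (toFun a b) (toFun a b') = zero
  oplus_right : ∀ a b b', odot b b' = zero →
    toFun a (oplus b b') = oplus (toFun a b) (toFun a b')

/-- Postcomposition of a bimorphism with a homomorphism. -/
def Bimorphism.post {A : Type u} {B : Type v} {C : Type w} {D : Type*}
    [MVAlgebra A] [MVAlgebra B] [MVAlgebra C] [MVAlgebra D]
    (β : Bimorphism A B C) (f : MVHom C D) : Bimorphism A B D where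
  toFun a b := f (β.toFun a b)
  map_one_one := by rw [β.map_one_one, f.map_one]
  map_zero_left b := by rw [β.map_zero_left, f.map_zero]
  map_zero_right a := by rw [β.map_zero_right, f.map_zero]
  map_sup_left a a' b := by rw [β.map_sup_left, f.map_sup]
  map_inf_left a a' b := by rw [β.map_inf_left, f.map_inf]
  map_sup_right a b b' := by rw [β.map_sup_right, f.map_sup]
  map_inf_right a b b' := by rw [β.map_inf_right, f.map_inf]
  odot_left a a' b h := by rw [← f.map_odot, β.odot_left a a' b h, f.map_zero]
  oplus_left a a' b h := by rw [β.oplus_left a a' b h, f.map_oplus]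
  odot_right a b b' h := by rw [← f.map_odot, β.odot_right a b b' h, f.map_zero]
  oplus_right a b b' h := by rw [β.oplus_right a b b' h, f.map_oplus]

/-- Precomposition of a bimorphism with a homomorphism in the second argument. -/
def Bimorphism.pre {A : Type u} {B B' : Type v} {C : Type w}
    [MVAlgebra A] [MVAlgebra B] [MVAlgebra B'] [MVAlgebra C]
    (β : Bimorphism A B' C) (f : MVHom B B') : Bimorphism A B C where
  toFun a b := β.toFun a (f b)
  map_one_one := by rw [f.map_one, β.map_one_one]
  map_zero_left b := β.map_zero_left _
  map_zero_right a := by rw [f.map_zero, β.map_zero_right]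
  map_sup_left a a' b := β.map_sup_left _ _ _
  map_inf_left a a' b := β.map_inf_left _ _ _
  map_sup_right a b b' := by rw [f.map_sup, β.map_sup_right]
  map_inf_right a b b' := by rw [f.map_inf, β.map_inf_right]
  odot_left a a' b h := β.odot_left _ _ _ h
  oplus_left a a' b h := β.oplus_left _ _ _ h
  odot_right a b b' h := β.odot_right _ _ _ (by rw [← f.map_odot, h, f.map_zero])
  oplus_right a b b' h := by
    rw [f.map_oplus, β.oplus_right _ _ _ (by rw [← f.map_odot, h, f.map_zero])]

/-- Pointwise structure on an algebra of functions. -/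
instance instMVPi {X : Type u} {A : Type v} [MVAlgebra A] : MVAlgebra (X → A) where
  oplus f g x := oplus (f x) (g x)
  neg f x := neg (f x)
  zero _ := zero
  oplus_assoc _ _ _ := funext fun _ => oplus_assoc _ _ _
  oplus_comm _ _ := funext fun _ => oplus_comm _ _
  oplus_zero _ := funext fun _ => oplus_zero _
  neg_neg _ := funext fun _ => MVAlgebra.neg_neg _
  neg_zero_oplus _ := funext fun _ => neg_zero_oplus _
  luk _ _ := funext fun _ => luk _ _

/-- Membership in the MV-subalgebra generated by `S`. -/
inductive Generated {A : Type u} [MVAlgebra A] (S : Set A) : A → Prop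
  | basic {x} : x ∈ S → Generated S x
  | zero : Generated S zero
  | neg {x} : Generated S x → Generated S (neg x)
  | oplus {x y} : Generated S x → Generated S y → Generated S (oplus x y)

instance instMVGenerated {A : Type u} [MVAlgebra A] (S : Set A) :
    MVAlgebra {x : A // Generated S x} where
  oplus x y := ⟨oplus x.1 y.1, Generated.oplus x.2 y.2⟩
  neg x := ⟨neg x.1, Generated.neg x.2⟩
  zero := ⟨zero, Generated.zero⟩
  oplus_assoc _ _ _ := Subtype.ext (oplus_assoc _ _ _)
  oplus_comm _ _ := Subtype.ext (oplus_comm _ _)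
  oplus_zero _ := Subtype.ext (oplus_zero _)
  neg_neg _ := Subtype.ext (MVAlgebra.neg_neg _)
  neg_zero_oplus _ := Subtype.ext (neg_zero_oplus _)
  luk _ _ := Subtype.ext (luk _ _)

/-- The function `β ↦ β(a, b)` on the set of bimorphisms `A × B → [0,1]`. -/
def pureFun {A : Type u} {B : Type v} [MVAlgebra A] [MVAlgebra B] (a : A) (b : B) :
    Bimorphism A B UnitR → UnitR := fun β => β.toFun a b

/-- The semisimple tensor product `A ⊗ B`, that is, the universal semisimple MV-algebra with a
bimorphism from `A × B`. It is realized as the algebra of functions on the set of bimorphisms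
`A × B → [0,1]` generated by the functions `β ↦ β(a, b)`; `SSTensor.semisimple` and
`SSTensor.existsUnique_lift` are the universal property. -/
def SSTensor (A : Type u) (B : Type v) [MVAlgebra A] [MVAlgebra B] : Type (max u v) :=
  {F : Bimorphism A B UnitR → UnitR // Generated {G | ∃ a b, G = pureFun a b} F}

namespace SSTensor

noncomputable instance (A : Type u) (B : Type v) [MVAlgebra A] [MVAlgebra B] :
    MVAlgebra (SSTensor A B) :=
  instMVGenerated _

variable {A : Type u} {B : Type v} [MVAlgebra A] [MVAlgebra B]

@[ext]
theorem ext {F G : SSTensor A B} (h : ∀ β, F.1 β = G.1 β) : F = G :=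
  Subtype.ext (funext h)

/-- The elementary tensor `a ⊗ b`. -/
def tmul (a : A) (b : B) : SSTensor A B := ⟨pureFun a b, Generated.basic ⟨a, b, rfl⟩⟩

/-- Evaluation at a bimorphism into `[0,1]`. -/
def evalHom (β : Bimorphism A B UnitR) : MVHom (SSTensor A B) UnitR where
  toFun F := F.1 β
  map_oplus _ _ := rfl
  map_neg _ := rfl
  map_zero := rfl

theorem semisimple : Semisimple (SSTensor A B) :=
  fun _ _ h => ext fun β => h (evalHom β)

/-- Induction from the elementary tensors. -/
theorem induction {p : SSTensor A B → Prop} (ht : ∀ a b, p (tmul a b)) (h0 : p zero)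
    (hn : ∀ F, p F → p (neg F)) (ho : ∀ F G, p F → p G → p (oplus F G)) (F : SSTensor A B) :
    p F := by
  obtain ⟨F, hF⟩ := F
  induction hF with
  | basic h =>
    obtain ⟨a, b, rfl⟩ := h
    exact ht a b
  | zero => exact h0
  | neg h ih => exact hn ⟨_, h⟩ ih
  | oplus h h' ih ih' => exact ho ⟨_, h⟩ ⟨_, h'⟩ ih ih'

theorem hom_ext {C : Type w} [MVAlgebra C] {f g : MVHom (SSTensor A B) C}
    (h : ∀ a b, f (tmul a b) = g (tmul a b)) : f = g := by
  refine MVHom.ext (funext fun F => ?_)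
  induction F using SSTensor.induction with
  | ht a b => exact h a b
  | h0 => rw [f.map_zero, g.map_zero]
  | hn F ih => rw [f.map_neg, g.map_neg, ih]
  | ho F G ih ih' => rw [f.map_oplus, g.map_oplus, ih, ih']

/-- The universal bimorphism `(a, b) ↦ a ⊗ b`. -/
def tmulBi (A : Type u) (B : Type v) [MVAlgebra A] [MVAlgebra B] :
    Bimorphism A B (SSTensor A B) where
  toFun := tmul
  map_one_one := ext fun β => β.map_one_one
  map_zero_left b := ext fun β => β.map_zero_left b
  map_zero_right a := ext fun β => β.map_zero_right a
  map_sup_left a a' b := ext fun β => β.map_sup_left a a' b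
  map_inf_left a a' b := ext fun β => β.map_inf_left a a' b
  map_sup_right a b b' := ext fun β => β.map_sup_right a b b'
  map_inf_right a b b' := ext fun β => β.map_inf_right a b b'
  odot_left a a' b h := ext fun β => β.odot_left a a' b h
  oplus_left a a' b h := ext fun β => β.oplus_left a a' b h
  odot_right a b b' h := ext fun β => β.odot_right a b b' h
  oplus_right a b b' h := ext fun β => β.oplus_right a b b' h

/-- The universal property of the semisimple tensor product. -/
theorem existsUnique_lift {C : Type w} [MVAlgebra C] (hC : Semisimple C)
    (β : Bimorphism A B C) :
    ∃! f : MVHom (SSTensor A B) C, ∀ a b, f (tmul a b) = β.toFun a b := by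
  have key : ∀ F : SSTensor A B, ∃ c : C, ∀ φ : MVHom C UnitR, φ c = F.1 (β.post φ) := by
    intro F
    induction F using SSTensor.induction with
    | ht a b => exact ⟨β.toFun a b, fun φ => rfl⟩
    | h0 => exact ⟨zero, fun φ => φ.map_zero⟩
    | hn F ih =>
      obtain ⟨c, hc⟩ := ih
      exact ⟨neg c, fun φ => (φ.map_neg c).trans (congrArg neg (hc φ))⟩
    | ho F G ih ih' =>
      obtain ⟨c, hc⟩ := ih
      obtain ⟨d, hd⟩ := ih'
      exact ⟨oplus c d, fun φ => (φ.map_oplus c d).trans (congrArg₂ oplus (hc φ) (hd φ))⟩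
  choose f hf using key
  refine ⟨⟨f, ?_, ?_, ?_⟩, ?_, ?_⟩
  · intro F G
    refine hC _ _ fun φ => ?_
    rw [hf, φ.map_oplus, hf, hf]
    rfl
  · intro F
    refine hC _ _ fun φ => ?_
    rw [hf, φ.map_neg, hf]
    rfl
  · refine hC _ _ fun φ => ?_
    rw [hf, φ.map_zero]
    rfl
  · intro a b
    refine hC _ _ fun φ => ?_
    exact hf _ φ
  · intro g hg
    refine hom_ext fun a b => ?_
    rw [hg]
    exact (hC _ _ fun φ => hf _ φ).symm

end SSTensor

/-! ### The DMV-algebra `([0,1] ∩ ℚ) ⊗ A` -/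

/-- Product of a real in `[0,1]` by a rational in `[0,1]`. -/
noncomputable def qscale (q : UnitQ) (x : UnitR) : UnitR :=
  ⟨(q.1 : ℝ) * x.1, mul_nonneg (Rat.cast_nonneg.2 q.2.1) x.2.1,
    mul_le_one₀ (by exact_mod_cast q.2.2) x.2.1 x.2.2⟩

section RatTensor

variable {A : Type u} [MVAlgebra A]

theorem bimorphism_add (β : Bimorphism UnitQ A UnitR) (x y z : UnitQ) (h : x.1 + y.1 = z.1)
    (a : A) : (β.toFun z a).1 = (β.toFun x a).1 + (β.toFun y a).1 := by
  have hz := z.2.2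
  have h0 : odot x y = zero := Subtype.ext (by
    rw [coe_odot, coe_zero]
    exact max_eq_left (by linarith))
  have h1 : z = oplus x y := Subtype.ext (by
    rw [coe_oplus, h]
    exact (min_eq_right hz).symm)
  have h2 := congrArg Subtype.val (β.odot_left x y a h0)
  rw [coe_odot, coe_zero] at h2
  rw [h1, β.oplus_left x y a h0, coe_oplus]
  exact min_eq_right (by linarith [le_max_right 0 ((β.toFun x a).1 + (β.toFun y a).1 - 1)])

theorem bimorphism_nat (β : Bimorphism UnitQ A UnitR) (x : UnitQ) (a : A) (k : ℕ) :
    ∀ z : UnitQ, (k : ℚ) * x.1 = z.1 → (β.toFun z a).1 = k * (β.toFun x a).1 := by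
  induction k with
  | zero =>
    intro z hz
    have : z = zero := Subtype.ext (by rw [coe_zero, ← hz]; simp)
    rw [this, β.map_zero_left, coe_zero]
    simp
  | succ k ih =>
    intro z hz
    push_cast at hz
    have hx := x.2.1
    have hk : (0 : ℚ) ≤ k * x.1 := mul_nonneg (Nat.cast_nonneg k) hx
    let w : UnitQ := ⟨k * x.1, hk, by have := z.2.2; linarith⟩
    rw [bimorphism_add β w x z (by rw [← hz]; ring) a, ih w rfl]
    push_cast
    ring

theorem bimorphism_qmul (β : Bimorphism UnitQ A UnitR) (q p : UnitQ) (a : A) :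
    β.toFun (q * p) a = qscale q (β.toFun p a) := by
  have hd : (0 : ℚ) < q.1.den := by exact_mod_cast q.1.den_pos
  have hd1 : (1 : ℚ) ≤ q.1.den := by exact_mod_cast q.1.den_pos
  have hnum : ((q.1.num.toNat : ℕ) : ℚ) = q.1.num := by
    exact_mod_cast Int.toNat_of_nonneg (Rat.num_nonneg.2 q.2.1)
  have hq : q.1 = (q.1.num.toNat : ℚ) / q.1.den := by rw [hnum, Rat.num_div_den]
  let x : UnitQ := ⟨p.1 / q.1.den, div_nonneg p.2.1 hd.le,
    (div_le_one hd).2 (p.2.2.trans hd1)⟩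
  have h1 := bimorphism_nat β x a q.1.den p (mul_div_cancel₀ p.1 hd.ne')
  have h2 := bimorphism_nat β x a q.1.num.toNat (q * p) (by
    change (q.1.num.toNat : ℚ) * (p.1 / q.1.den) = q.1 * p.1
    conv_rhs => rw [hq]
    ring)
  refine Subtype.ext ?_
  change (β.toFun (q * p) a).1 = (q.1 : ℝ) * (β.toFun p a).1
  have hqr : (q.1 : ℝ) = (q.1.num.toNat : ℝ) / q.1.den := by
    have h3 := congrArg (fun t : ℚ => (t : ℝ)) hq
    simp only [Rat.cast_div, Rat.cast_natCast] at h3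
    exact h3
  have hdr : (q.1.den : ℝ) ≠ 0 := by exact_mod_cast hd.ne'
  rw [h1, h2, hqr]
  field_simp

end RatTensor

namespace SSTensor

variable {A : Type u} [MVAlgebra A]

theorem generated_qscale (q : UnitQ) (F : SSTensor UnitQ A) :
    ∃ G : SSTensor UnitQ A, ∀ β, G.1 β = qscale q (F.1 β) := by
  have hq1 : ∀ β : Bimorphism UnitQ A UnitR, ((tmul q one : SSTensor UnitQ A).1 β).1 = q.1 := by
    intro β
    have h := bimorphism_qmul β q 1 one
    have h1 : (1 : UnitQ) = one := Subtype.ext (by rw [coe_one]; rfl)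
    rw [mul_one, h1, β.map_one_one] at h
    have h' := congrArg Subtype.val h
    change (β.toFun q one).1 = (q.1 : ℝ) * (one : UnitR).1 at h'
    rw [coe_one, mul_one] at h'
    exact h'
  have hqn : (0 : ℝ) ≤ q.1 := Rat.cast_nonneg.2 q.2.1
  have hql : (q.1 : ℝ) ≤ 1 := by exact_mod_cast q.2.2
  induction F using SSTensor.induction with
  | ht p a => exact ⟨tmul (q * p) a, fun β => bimorphism_qmul β q p a⟩
  | h0 =>
    refine ⟨zero, fun β => Subtype.ext ?_⟩
    change (0 : ℝ) = (q.1 : ℝ) * 0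
    rw [mul_zero]
  | hn F ih =>
    obtain ⟨G, hG⟩ := ih
    refine ⟨odot (tmul q one) (neg G), fun β => Subtype.ext ?_⟩
    change (odot ((tmul q one : SSTensor UnitQ A).1 β) (neg (G.1 β))).1
      = (q.1 : ℝ) * (1 - (F.1 β).1)
    rw [coe_odot, coe_neg, hq1, hG]
    change max 0 ((q.1 : ℝ) + (1 - (q.1 : ℝ) * (F.1 β).1) - 1) = _
    have h := mul_nonneg hqn (sub_nonneg.2 (F.1 β).2.2)
    rw [max_eq_right (by linarith)]
    ring
  | ho F F' ih ih' =>
    obtain ⟨G, hG⟩ := ih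
    obtain ⟨G', hG'⟩ := ih'
    refine ⟨inf (tmul q one) (oplus G G'), fun β => Subtype.ext ?_⟩
    change (inf ((tmul q one : SSTensor UnitQ A).1 β) (oplus (G.1 β) (G'.1 β))).1
      = (q.1 : ℝ) * min 1 ((F.1 β).1 + (F'.1 β).1)
    rw [coe_inf, coe_oplus, hq1, hG, hG']
    change min (q.1 : ℝ) (min 1 ((q.1 : ℝ) * (F.1 β).1 + (q.1 : ℝ) * (F'.1 β).1)) = _
    rw [← min_assoc, min_eq_left hql, ← mul_add, mul_min_of_nonneg _ _ hqn, mul_one]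

/-- The scalar multiplication of `([0,1] ∩ ℚ) ⊗ A`, with `q (p ⊗ a) = (q p) ⊗ a`. -/
noncomputable def qmulFun (q : UnitQ) (F : SSTensor UnitQ A) : SSTensor UnitQ A :=
  ⟨fun β => qscale q (F.1 β), by
    obtain ⟨G, hG⟩ := generated_qscale q F
    rw [← funext hG]
    exact G.2⟩

theorem qmulFun_tmul (q p : UnitQ) (a : A) : qmulFun q (tmul p a) = tmul (q * p) a :=
  SSTensor.ext fun β => (bimorphism_qmul β q p a).symm

noncomputable instance : DMVAlgebra (SSTensor UnitQ A) where
  qmul := qmulFun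
  qmul_odot_neg q F G := by
    refine SSTensor.ext fun β => Subtype.ext ?_
    change (q.1 : ℝ) * (odot (F.1 β) (neg (G.1 β))).1
      = (odot (qscale q (F.1 β)) (neg (qscale q (G.1 β)))).1
    have hqn : (0 : ℝ) ≤ q.1 := Rat.cast_nonneg.2 q.2.1
    rw [coe_odot, coe_odot, coe_neg, coe_neg, mul_max_of_nonneg _ _ hqn]
    change _ = max 0 ((q.1 : ℝ) * (F.1 β).1 + (1 - (q.1 : ℝ) * (G.1 β).1) - 1)
    congr 1 <;> ring
  odot_neg_qmul r q F := by
    refine SSTensor.ext fun β => Subtype.ext ?_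
    change ((odot r (neg q)).1 : ℝ) * (F.1 β).1
      = (odot (qscale r (F.1 β)) (neg (qscale q (F.1 β)))).1
    rw [coe_odot, coe_odot, coe_neg, coe_neg]
    change _ = max 0 ((r.1 : ℝ) * (F.1 β).1 + (1 - (q.1 : ℝ) * (F.1 β).1) - 1)
    push_cast
    rw [max_mul_of_nonneg _ _ (F.1 β).2.1]
    congr 1 <;> ring
  qmul_qmul r q F := by
    refine SSTensor.ext fun β => Subtype.ext ?_
    change (r.1 : ℝ) * ((q.1 : ℝ) * (F.1 β).1) = ((r.1 * q.1 : ℚ) : ℝ) * (F.1 β).1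
    push_cast
    ring
  one_qmul F := by
    refine SSTensor.ext fun β => Subtype.ext ?_
    change ((1 : ℚ) : ℝ) * (F.1 β).1 = (F.1 β).1
    rw [Rat.cast_one, one_mul]

/-- The canonical map `ι_A : A → ([0,1] ∩ ℚ) ⊗ A`, `a ↦ 1 ⊗ a`. -/
def incl (a : A) : SSTensor UnitQ A := tmul one a

variable {B : Type u} [MVAlgebra B]

theorem generated_pre (f : MVHom A B) (F : SSTensor UnitQ A) :
    Generated {G | ∃ p b, G = pureFun (A := UnitQ) (B := B) p b} (fun β => F.1 (β.pre f)) := by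
  induction F using SSTensor.induction with
  | ht p a => exact Generated.basic ⟨p, f a, rfl⟩
  | h0 => exact Generated.zero
  | hn F ih => exact Generated.neg ih
  | ho F G ih ih' => exact Generated.oplus ih ih'

/-- The homomorphism `([0,1] ∩ ℚ) ⊗ f`, with `p ⊗ a ↦ p ⊗ f(a)`. -/
noncomputable def map (f : MVHom A B) : DMVHom (SSTensor UnitQ A) (SSTensor UnitQ B) where
  toFun F := ⟨fun β => F.1 (β.pre f), generated_pre f F⟩
  map_oplus _ _ := rfl
  map_neg _ := rfl
  map_zero := rfl
  map_qmul _ _ := rfl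

theorem map_tmul (f : MVHom A B) (p : UnitQ) (a : A) : map f (tmul p a) = tmul p (f a) := rfl

theorem map_incl (f : MVHom A B) (a : A) : map f (incl a) = incl (f a) := rfl

/-- `([0,1] ∩ ℚ) ⊗ f` is the only DMV-homomorphism compatible with `ι_A` and `ι_B`. -/
theorem map_unique (f : MVHom A B) (g : DMVHom (SSTensor UnitQ A) (SSTensor UnitQ B))
    (hg : ∀ a, g (incl a) = incl (f a)) : g = map f := by
  have h : g.toMVHom = (map f).toMVHom := by
    refine hom_ext fun p a => ?_
    have h1 : (tmul p a : SSTensor UnitQ A) = qmul p (incl a) := by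
      have h2 : (one : UnitQ) = 1 := Subtype.ext (by rw [coe_one]; rfl)
      change _ = qmulFun p (tmul one a)
      rw [qmulFun_tmul, h2, mul_one]
    rw [h1, g.map_qmul, (map f).map_qmul, hg, map_incl]
  exact DMVHom.ext (congrArg MVHom.toFun h)

end SSTensor

/-! ### Categories and the tensor functor -/

/-- The category of MV-algebras. -/
structure MVCat : Type (u + 1) where
  carrier : Type u
  [str : MVAlgebra carrier]

attribute [instance] MVCat.str

instance : Category MVCat.{u} where
  Hom A B := MVHom A.carrier B.carrier
  id A := MVHom.id A.carrier
  comp f g := MVHom.comp g f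

/-- The category of DMV-algebras. -/
structure DMVCat : Type (u + 1) where
  carrier : Type u
  [str : DMVAlgebra carrier]

attribute [instance] DMVCat.str

instance : Category DMVCat.{u} where
  Hom A B := DMVHom A.carrier B.carrier
  id A := DMVHom.id A.carrier
  comp f g := DMVHom.comp g f

/-- Semisimple MV-algebras. -/
def ssMV : ObjectProperty MVCat.{u} := fun A => Semisimple A.carrier

/-- Finitely presented MV-algebras. -/
def fpMV : ObjectProperty MVCat.{u} := fun A => FinPresMV A.carrier

/-- DMV-algebras with semisimple MV-algebra reduct. -/
def ssDMV : ObjectProperty DMVCat.{u} := fun A => Semisimple A.carrier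

/-- Finitely presented DMV-algebras. -/
def fpDMV : ObjectProperty DMVCat.{u} := fun A => FinPresDMV A.carrier

/-- The functor `A ↦ ([0,1] ∩ ℚ) ⊗ A` from semisimple MV-algebras to semisimple DMV-algebras. -/
noncomputable def tensorFunctor : ssMV.{u}.FullSubcategory ⥤ ssDMV.{u}.FullSubcategory where
  obj A := ⟨⟨SSTensor UnitQ A.obj.carrier⟩, SSTensor.semisimple⟩
  map f := ObjectProperty.homMk (SSTensor.map f.hom)
  map_id _ := rfl
  map_comp _ _ := rfl

/-- The restriction and corestriction of the tensor functor to finitely presented algebras; it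
makes sense as soon as finitely presented MV-algebras are semisimple (`h₁`) and the functor
takes finitely presented algebras to finitely presented algebras (`h₂`). -/
noncomputable def tensorFunctorFP (h₁ : fpMV.{u} ≤ ssMV.{u})
    (h₂ : ∀ A : fpMV.{u}.FullSubcategory,
      fpDMV.{u} (tensorFunctor.obj ((ObjectProperty.ιOfLE h₁).obj A)).obj) :
    fpMV.{u}.FullSubcategory ⥤ fpDMV.{u}.FullSubcategory :=
  fpDMV.{u}.lift (ObjectProperty.ιOfLE h₁ ⋙ tensorFunctor.{u} ⋙ ssDMV.{u}.ι) h₂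

end MV

/-! Elements of `MV_n` and `DMV_n` can be evaluated at the points of the cube `[0,1]^n`, and the
whole proof rests on the fact that the principal ideal `(a]` contains every `b` that vanishes
wherever `a` does (`FreeMV.mem_principalIdeal`, `FreeDMV.mem_principalIdeal`). If `b ∉ (a]`, some
ideal contains `a`, omits `b` and has a linearly ordered quotient. That chain is the unit interval
of an ordered abelian group, whose divisible hull is an ordered rational vector space. Only finitely
many comparisons of vectors matter for evaluating the two terms. Fourier–Motzkin elimination
(`exists_rat_solution`) yields a rational functional respecting all of them, and normalising it by
the unit turns the generators into a point of the cube where `a` vanishes and `b` does not.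

Semisimplicity follows: points in the zero set of `a` are homomorphisms of `MV_n/(a]` into `[0,1]`,
and they separate its elements. A homomorphism `φ : A → [0,1]` also gives the bimorphism `(q, x) ↦ q
φ(x)`, so every `φ` extends to `[0,1]_Q ⊗ A`. Therefore `ι_A` is injective for semisimple `A`, which
gives faithfulness. The same extensions show that if `A` is `MV_n/(a]`, then `[0,1]_Q ⊗ A` is
`DMV_n` modulo the ideal generated by the image of `a` (`SSTensor.presentation_ker`).

Essential surjectivity is thereby reduced to the statement on principal ideals, that is, to finding
an MV-term with the same zeros as a given DMV-term `t`. Clearing denominators, some positive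
multiple `N t` lies in the lattice-ordered group generated by the MV-term functions and the constant
1, and truncating it to `[0,1]` gives an MV-term function (`DMVTerm.exists_same_zeros`). -/

namespace MV

open MVAlgebra DMVAlgebra

/-! ### Arithmetic and order in MV-algebras. -/

section Basic

variable {A : Type u} [MVAlgebra A]

theorem zero_oplus (x : A) : oplus zero x = x := by rw [oplus_comm, oplus_zero]

theorem one_oplus (x : A) : oplus one x = one := neg_zero_oplus x

theorem oplus_one (x : A) : oplus x one = one := by rw [oplus_comm, one_oplus]

theorem neg_one : neg (one : A) = zero := MVAlgebra.neg_neg _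

theorem neg_zero : neg (zero : A) = one := rfl

theorem neg_oplus_self (x : A) : oplus (neg x) x = one := by
  have h := luk x one
  rw [oplus_one, neg_one, zero_oplus] at h
  exact h.symm

theorem oplus_neg_self (x : A) : oplus x (neg x) = one := by rw [oplus_comm, neg_oplus_self]

theorem oplus_left_comm (x y z : A) : oplus x (oplus y z) = oplus y (oplus x z) := by
  rw [← oplus_assoc, oplus_comm x y, oplus_assoc]

theorem odot_comm (x y : A) : odot x y = odot y x := by rw [odot, odot, oplus_comm]

theorem odot_assoc (x y z : A) : odot (odot x y) z = odot x (odot y z) := by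
  simp only [odot, MVAlgebra.neg_neg, oplus_assoc]

theorem odot_one (x : A) : odot x one = x := by
  rw [odot, neg_one, oplus_zero, MVAlgebra.neg_neg]

theorem one_odot (x : A) : odot one x = x := by rw [odot_comm, odot_one]

theorem odot_zero (x : A) : odot x zero = zero := by
  rw [odot, neg_zero, oplus_one, neg_one]

theorem zero_odot (x : A) : odot zero x = zero := by rw [odot_comm, odot_zero]

theorem odot_neg_self (x : A) : odot x (neg x) = zero := by
  rw [odot, MVAlgebra.neg_neg, neg_oplus_self, neg_one]

theorem neg_odot (x y : A) : neg (odot x y) = oplus (neg x) (neg y) := MVAlgebra.neg_neg _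

theorem neg_oplus (x y : A) : neg (oplus x y) = odot (neg x) (neg y) := by
  simp only [odot, MVAlgebra.neg_neg]

theorem neg_injective {x y : A} (h : neg x = neg y) : x = y := by
  rw [← MVAlgebra.neg_neg x, h, MVAlgebra.neg_neg]

theorem sup_comm (x y : A) : sup x y = sup y x := by
  have h := luk y x
  simp only [sup, odot, MVAlgebra.neg_neg]
  rw [oplus_comm x, oplus_comm y, h]

theorem le_iff_neg_oplus {x y : A} : le x y ↔ oplus (neg x) y = one := by
  constructor
  · intro h
    rw [← h, sup, ← oplus_assoc, neg_oplus_self, one_oplus]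
  · intro h
    rw [le, sup_comm, sup, odot, MVAlgebra.neg_neg, h, neg_one, oplus_zero]

theorem le_iff_odot_neg {x y : A} : le x y ↔ odot x (neg y) = zero := by
  rw [le_iff_neg_oplus, odot, MVAlgebra.neg_neg]
  constructor
  · intro h
    rw [h, neg_one]
  · intro h
    rw [← MVAlgebra.neg_neg (oplus _ _), h, neg_zero]

theorem le_refl (x : A) : le x x := le_iff_neg_oplus.2 (neg_oplus_self x)

theorem le_oplus_left (x y : A) : le x (oplus x y) := by
  rw [le_iff_neg_oplus, ← oplus_assoc, neg_oplus_self, one_oplus]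

theorem le_oplus_right (x y : A) : le y (oplus x y) := by
  rw [oplus_comm]
  exact le_oplus_left y x

theorem le.exists_oplus {x y : A} (h : le x y) : ∃ z, y = oplus x z := ⟨_, h.symm⟩

theorem le_antisymm {x y : A} (h : le x y) (h' : le y x) : x = y := by
  rw [← h', sup_comm, h]

theorem le_trans {x y z : A} (h : le x y) (h' : le y z) : le x z := by
  obtain ⟨a, rfl⟩ := h.exists_oplus
  obtain ⟨b, rfl⟩ := h'.exists_oplus
  rw [oplus_assoc]
  exact le_oplus_left _ _

theorem zero_le (x : A) : le zero x := le_iff_neg_oplus.2 (one_oplus x)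

theorem le_one (x : A) : le x one := le_iff_neg_oplus.2 (oplus_one _)

theorem le_zero {x : A} (h : le x zero) : x = zero := le_antisymm h (zero_le x)

theorem neg_le_neg {x y : A} (h : le x y) : le (neg y) (neg x) := by
  rw [le_iff_neg_oplus] at h ⊢
  rw [MVAlgebra.neg_neg, oplus_comm, h]

theorem oplus_le_oplus {x y z w : A} (h : le x y) (h' : le z w) :
    le (oplus x z) (oplus y w) := by
  obtain ⟨a, rfl⟩ := h.exists_oplus
  obtain ⟨b, rfl⟩ := h'.exists_oplus
  rw [oplus_assoc, oplus_left_comm a, ← oplus_assoc]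
  exact le_oplus_left _ _

theorem odot_le_odot {x y z w : A} (h : le x y) (h' : le z w) :
    le (odot x z) (odot y w) :=
  neg_le_neg (oplus_le_oplus (neg_le_neg h) (neg_le_neg h'))

theorem odot_le_left (x y : A) : le (odot x y) x := by
  have h := odot_le_odot (le_refl x) (le_one y)
  rwa [odot_one] at h

theorem odot_le_right (x y : A) : le (odot x y) y := by
  rw [odot_comm]
  exact odot_le_left y x

/-- Residuation. -/
theorem odot_neg_le_iff {x y z : A} : le (odot x (neg y)) z ↔ le x (oplus y z) := by
  rw [le_iff_neg_oplus, le_iff_neg_oplus, neg_odot, MVAlgebra.neg_neg, oplus_assoc]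

theorem le_sup_left (x y : A) : le x (sup x y) := le_oplus_left _ _

theorem le_sup_right (x y : A) : le y (sup x y) := by
  rw [sup_comm]
  exact le_oplus_left _ _

theorem sup_le {x y z : A} (h : le x z) (h' : le y z) : le (sup x y) z := by
  have h1 : le (sup x y) (sup x z) :=
    oplus_le_oplus (le_refl x) (odot_le_odot h' (le_refl _))
  rwa [show sup x z = z from h] at h1

theorem inf_le_left (x y : A) : le (inf x y) x := by
  have h := neg_le_neg (le_sup_left (neg x) (neg y))
  rwa [MVAlgebra.neg_neg] at h

theorem inf_le_right (x y : A) : le (inf x y) y := by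
  have h := neg_le_neg (le_sup_right (neg x) (neg y))
  rwa [MVAlgebra.neg_neg] at h

theorem le_inf {x y z : A} (h : le z x) (h' : le z y) : le z (inf x y) := by
  have h1 := neg_le_neg (sup_le (neg_le_neg h) (neg_le_neg h'))
  rwa [MVAlgebra.neg_neg] at h1

theorem odot_neg_oplus_cancel {x y : A} (h : le y x) : oplus (odot x (neg y)) y = x := by
  rw [oplus_comm]
  exact h

theorem oplus_odot_neg_cancel {x y : A} (h : le x (neg y)) : odot (oplus x y) (neg y) = x := by
  have h1 := neg_le_neg h
  rw [MVAlgebra.neg_neg] at h1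
  refine neg_injective ?_
  rw [neg_odot, MVAlgebra.neg_neg, neg_oplus]
  exact odot_neg_oplus_cancel h1

theorem oplus_right_cancel {x y z : A} (hx : le x (neg z)) (hy : le y (neg z))
    (h : oplus x z = oplus y z) : x = y := by
  rw [← oplus_odot_neg_cancel hx, h, oplus_odot_neg_cancel hy]

theorem inf_eq_oplus_odot (x y : A) : inf x y = odot x (oplus (neg x) y) := by
  simp only [inf, sup, odot, MVAlgebra.neg_neg]
  rw [oplus_comm y]

theorem inf_of_le {x y : A} (h : le x y) : inf x y = x :=
  le_antisymm (inf_le_left x y) (le_inf (le_refl x) h)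

theorem inf_comm (x y : A) : inf x y = inf y x := by rw [inf, sup_comm, inf]

theorem inf_oplus_odot_neg (x y : A) : oplus (inf x y) (odot x (neg y)) = x := by
  rw [inf_eq_oplus_odot, show oplus (neg x) y = neg (odot x (neg y)) by
    rw [neg_odot, MVAlgebra.neg_neg]]
  exact odot_neg_oplus_cancel (odot_le_left _ _)

/-- A common lower bound `w` of the two differences can be added to `x ∧ y` without leaving either
`x` or `y`. So `w ⊕ (x ∧ y) ≤ x ∧ y`, and cancelling `x ∧ y` leaves `w = 0`. -/
theorem prelinearity (x y : A) : inf (odot x (neg y)) (odot y (neg x)) = zero := by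
  set w := inf (odot x (neg y)) (odot y (neg x)) with hw
  have h1 : le (oplus w (inf x y)) x := by
    have h := oplus_le_oplus (inf_le_left (odot x (neg y)) (odot y (neg x))) (le_refl (inf x y))
    rwa [oplus_comm (odot x (neg y)), inf_oplus_odot_neg] at h
  have h2 : le (oplus w (inf x y)) y := by
    have h := oplus_le_oplus (inf_le_right (odot x (neg y)) (odot y (neg x))) (le_refl (inf x y))
    rwa [oplus_comm (odot y (neg x)), inf_comm x y, inf_oplus_odot_neg, inf_comm y x] at h
  have h3 : le w (neg (inf x y)) :=
    le_trans (le_trans (inf_le_left _ _) (odot_le_right _ _)) (neg_le_neg (inf_le_right x y))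
  have h4 := odot_le_odot (le_inf h1 h2) (le_refl (neg (inf x y)))
  rw [oplus_odot_neg_cancel h3, odot_neg_self] at h4
  exact le_zero h4

/-- For `w = (x ⊕ y) ∧ z`, the part of `w` exceeding `x` lies below both `y` and `z`, hence is zero.
Then `w` itself lies below `x` and `z`. -/
theorem inf_oplus_eq_zero {x y z : A} (h : inf x z = zero) (h' : inf y z = zero) :
    inf (oplus x y) z = zero := by
  set w := inf (oplus x y) z with hw
  have h1 : le (odot w (neg x)) y := odot_neg_le_iff.2 (inf_le_left _ _)
  have h2 : le (odot w (neg x)) z := le_trans (odot_le_left _ _) (inf_le_right _ _)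
  have h3 := le_inf h1 h2
  rw [h', odot_neg_le_iff, oplus_zero] at h3
  have h4 := le_inf h3 (inf_le_right (oplus x y) z)
  rw [h] at h4
  exact le_zero h4

theorem nmul_inf_eq_zero {x y : A} (h : inf x y = zero) (m : ℕ) : inf (nmul m x) y = zero := by
  induction m with
  | zero => exact le_zero (inf_le_left _ _)
  | succ m ih => exact inf_oplus_eq_zero ih h

theorem nmul_add (m k : ℕ) (x : A) : nmul (m + k) x = oplus (nmul m x) (nmul k x) := by
  induction k with
  | zero => exact (oplus_zero _).symm
  | succ k ih =>
    change oplus (nmul (m + k) x) x = oplus _ (oplus _ x)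
    rw [ih, oplus_assoc]

theorem one_nmul (x : A) : nmul 1 x = x := zero_oplus x

theorem oplus_inf_le (x y z : A) : le (inf (oplus x y) (oplus x z)) (oplus x (inf y z)) :=
  odot_neg_le_iff.1 (le_inf (odot_neg_le_iff.2 (inf_le_left _ _))
    (odot_neg_le_iff.2 (inf_le_right _ _)))

end Basic

namespace MVHom

variable {A : Type u} {B : Type v} [MVAlgebra A] [MVAlgebra B]

theorem map_le (f : MVHom A B) {x y : A} (h : le x y) : le (f x) (f y) := by
  rw [le, ← f.map_sup]
  exact congrArg f h

end MVHom

/-! ### Ideals and quotients -/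

/-- Ideals of MV-algebras. -/
structure IsIdeal {A : Type u} [MVAlgebra A] (I : Set A) : Prop where
  zero_mem : zero ∈ I
  oplus_mem : ∀ {x y}, x ∈ I → y ∈ I → oplus x y ∈ I
  mem_of_le : ∀ {x y}, le x y → y ∈ I → x ∈ I

section Ideal

variable {A : Type u} [MVAlgebra A]

theorem IsIdeal.nmul_mem {I : Set A} (hI : IsIdeal I) {x : A} (hx : x ∈ I) (m : ℕ) :
    nmul m x ∈ I := by
  induction m with
  | zero => exact hI.zero_mem
  | succ m ih => exact hI.oplus_mem ih hx

/-- The ideal generated by `I` and `a`. -/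
def idealInsert (I : Set A) (a : A) : Set A := {x | ∃ p ∈ I, ∃ m : ℕ, le x (oplus p (nmul m a))}

theorem isIdeal_idealInsert {I : Set A} (hI : IsIdeal I) (a : A) : IsIdeal (idealInsert I a) where
  zero_mem := ⟨zero, hI.zero_mem, 0, zero_le _⟩
  oplus_mem := by
    rintro x y ⟨p, hp, m, hx⟩ ⟨q, hq, k, hy⟩
    refine ⟨oplus p q, hI.oplus_mem hp hq, m + k, ?_⟩
    have h := oplus_le_oplus hx hy
    rwa [oplus_assoc, oplus_left_comm (nmul m a), ← nmul_add, ← oplus_assoc] at h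
  mem_of_le := by
    rintro x y hxy ⟨p, hp, m, hx⟩
    exact ⟨p, hp, m, le_trans hxy hx⟩

theorem subset_idealInsert (I : Set A) (a : A) : I ⊆ idealInsert I a :=
  fun x hx => ⟨x, hx, 0, le_oplus_left _ _⟩

theorem mem_idealInsert {I : Set A} (hI : IsIdeal I) (a : A) : a ∈ idealInsert I a :=
  ⟨zero, hI.zero_mem, 1, by rw [zero_oplus, one_nmul]; exact le_refl a⟩

theorem isIdeal_principalIdeal (a : A) : IsIdeal (principalIdeal a) where
  zero_mem := ⟨0, zero_le _⟩
  oplus_mem := by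
    rintro x y ⟨m, hx⟩ ⟨k, hy⟩
    refine ⟨m + k, ?_⟩
    rw [nmul_add]
    exact oplus_le_oplus hx hy
  mem_of_le := by
    rintro x y hxy ⟨m, hx⟩
    exact ⟨m, le_trans hxy hx⟩

theorem mem_principalIdeal_self (a : A) : a ∈ principalIdeal a :=
  ⟨1, by rw [one_nmul]; exact le_refl a⟩

theorem IsIdeal.principalIdeal_subset {I : Set A} (hI : IsIdeal I) {a : A} (ha : a ∈ I) :
    principalIdeal a ⊆ I := by
  rintro x ⟨m, hx⟩
  exact hI.mem_of_le hx (hI.nmul_mem ha m)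

theorem isIdeal_ker {B : Type v} [MVAlgebra B] (f : MVHom A B) : IsIdeal {x | f x = zero} where
  zero_mem := f.map_zero
  oplus_mem := by
    intro x y hx hy
    change f _ = _
    rw [f.map_oplus, show f x = zero from hx, show f y = zero from hy, oplus_zero]
  mem_of_le := by
    intro x y h hy
    have h1 := f.map_le h
    rw [show f y = zero from hy] at h1
    exact le_zero h1

theorem MVHom.eq_iff {B : Type v} [MVAlgebra B] (f : MVHom A B) {x y : A} :
    f x = f y ↔ f (odot x (neg y)) = zero ∧ f (odot y (neg x)) = zero := by
  rw [f.map_odot, f.map_odot, f.map_neg, f.map_neg, ← le_iff_odot_neg, ← le_iff_odot_neg]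
  constructor
  · intro h
    rw [h]
    exact ⟨le_refl _, le_refl _⟩
  · exact fun h => le_antisymm h.1 h.2

theorem odot_neg_triangle (x y z : A) :
    le (odot x (neg z)) (oplus (odot x (neg y)) (odot y (neg z))) := by
  rw [odot_neg_le_iff]
  have h1 : le y (oplus z (odot y (neg z))) := odot_neg_le_iff.1 (le_refl _)
  have h2 : le x (oplus y (odot x (neg y))) := odot_neg_le_iff.1 (le_refl _)
  refine le_trans h2 ?_
  rw [oplus_left_comm z, oplus_comm y]
  exact oplus_le_oplus (le_refl _) h1

theorem oplus_odot_neg_oplus_le (x y z w : A) :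
    le (odot (oplus x z) (neg (oplus y w))) (oplus (odot x (neg y)) (odot z (neg w))) := by
  rw [odot_neg_le_iff, oplus_assoc, oplus_left_comm w, ← oplus_assoc]
  exact oplus_le_oplus (odot_neg_le_iff.1 (le_refl _)) (odot_neg_le_iff.1 (le_refl _))

/-- The congruence of an ideal. -/
def idealSetoid (I : Set A) (hI : IsIdeal I) : Setoid A where
  r x y := odot x (neg y) ∈ I ∧ odot y (neg x) ∈ I
  iseqv :=
    { refl := fun x => by
        rw [odot_neg_self]
        exact ⟨hI.zero_mem, hI.zero_mem⟩
      symm := fun h => ⟨h.2, h.1⟩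
      trans := fun {x y z} h h' =>
        ⟨hI.mem_of_le (odot_neg_triangle x y z) (hI.oplus_mem h.1 h'.1),
          hI.mem_of_le (odot_neg_triangle z y x) (hI.oplus_mem h'.2 h.2)⟩ }

/-- The quotient of an MV-algebra by an ideal. -/
def IdealQuotient (I : Set A) (hI : IsIdeal I) : Type u := Quotient (idealSetoid I hI)

instance (I : Set A) (hI : IsIdeal I) : MVAlgebra (IdealQuotient I hI) where
  oplus := Quotient.map₂ oplus (fun x y h z w h' =>
    ⟨hI.mem_of_le (oplus_odot_neg_oplus_le x y z w) (hI.oplus_mem h.1 h'.1),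
      hI.mem_of_le (oplus_odot_neg_oplus_le y x w z) (hI.oplus_mem h.2 h'.2)⟩)
  neg := Quotient.map neg (fun x y h => by
    change odot (neg x) (neg (neg y)) ∈ I ∧ odot (neg y) (neg (neg x)) ∈ I
    rw [MVAlgebra.neg_neg, MVAlgebra.neg_neg, odot_comm, odot_comm (neg y)]
    exact ⟨h.2, h.1⟩)
  zero := Quotient.mk _ zero
  oplus_assoc := by
    rintro ⟨x⟩ ⟨y⟩ ⟨z⟩
    exact congrArg (Quotient.mk _) (oplus_assoc x y z)
  oplus_comm := by
    rintro ⟨x⟩ ⟨y⟩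
    exact congrArg (Quotient.mk _) (oplus_comm x y)
  oplus_zero := by
    rintro ⟨x⟩
    exact congrArg (Quotient.mk _) (oplus_zero x)
  neg_neg := by
    rintro ⟨x⟩
    exact congrArg (Quotient.mk _) (MVAlgebra.neg_neg x)
  neg_zero_oplus := by
    rintro ⟨x⟩
    exact congrArg (Quotient.mk _) (neg_zero_oplus x)
  luk := by
    rintro ⟨x⟩ ⟨y⟩
    exact congrArg (Quotient.mk _) (luk x y)

/-- The projection to the quotient by an ideal. -/
def IdealQuotient.mk (I : Set A) (hI : IsIdeal I) : MVHom A (IdealQuotient I hI) where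
  toFun := Quotient.mk _
  map_oplus _ _ := rfl
  map_neg _ := rfl
  map_zero := rfl

theorem IdealQuotient.mk_surjective (I : Set A) (hI : IsIdeal I) :
    Function.Surjective (IdealQuotient.mk I hI) := Quotient.mk_surjective

theorem IdealQuotient.mk_eq_zero_iff {I : Set A} {hI : IsIdeal I} {x : A} :
    IdealQuotient.mk I hI x = zero ↔ x ∈ I := by
  refine Iff.trans (Quotient.eq (r := idealSetoid I hI)) ?_
  change odot x (neg zero) ∈ I ∧ odot zero (neg x) ∈ I ↔ _
  rw [neg_zero, odot_one, zero_odot]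
  exact and_iff_left hI.zero_mem

/-- An element outside an ideal can be separated from it by an ideal with linearly ordered
quotient. -/
theorem IsIdeal.exists_prime {I : Set A} (hI : IsIdeal I) {b : A} (hb : b ∉ I) :
    ∃ P : Set A, IsIdeal P ∧ I ⊆ P ∧ b ∉ P ∧
      ∀ x y, odot x (neg y) ∈ P ∨ odot y (neg x) ∈ P := by
  obtain ⟨P, hIP, hP⟩ := zorn_subset_nonempty {J : Set A | IsIdeal J ∧ b ∉ J} (by
    intro c hc hchain hne
    refine ⟨⋃₀ c, ⟨⟨?_, ?_, ?_⟩, ?_⟩, fun s hs => Set.subset_sUnion_of_mem hs⟩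
    · obtain ⟨s, hs⟩ := hne
      exact ⟨s, hs, (hc hs).1.zero_mem⟩
    · rintro x y ⟨s, hs, hx⟩ ⟨t, ht, hy⟩
      rcases hchain.total hs ht with h | h
      · exact ⟨t, ht, (hc ht).1.oplus_mem (h hx) hy⟩
      · exact ⟨s, hs, (hc hs).1.oplus_mem hx (h hy)⟩
    · rintro x y hxy ⟨s, hs, hx⟩
      exact ⟨s, hs, (hc hs).1.mem_of_le hxy hx⟩
    · rintro ⟨s, hs, hx⟩
      exact (hc hs).2 hx) I ⟨hI, hb⟩
  have hPI := hP.prop.1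
  -- Maximality of `P`: every proper enlargement captures `b`.
  have key : ∀ z, z ∉ P → b ∈ idealInsert P z := by
    intro z hz
    by_contra h
    exact hz (hP.le_of_ge ⟨isIdeal_idealInsert hPI z, h⟩ (subset_idealInsert P z)
      (mem_idealInsert hPI z))
  refine ⟨P, hPI, hIP, hP.prop.2, fun x y => ?_⟩
  by_contra! h
  obtain ⟨p, hp, m, h1⟩ := key _ h.1
  obtain ⟨q, hq, k, h2⟩ := key _ h.2
  -- `b` lies below `p ⊕ q` plus a multiple of either difference. Those multiples are disjoint by
  -- prelinearity, so `b ≤ p ⊕ q ∈ P`.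
  have h3 : le b (oplus (oplus p q) (nmul m (odot x (neg y)))) :=
    le_trans h1 (oplus_le_oplus (le_oplus_left _ _) (le_refl _))
  have h4 : le b (oplus (oplus p q) (nmul k (odot y (neg x)))) :=
    le_trans h2 (oplus_le_oplus (le_oplus_right _ _) (le_refl _))
  have h5 := le_trans (le_inf h3 h4) (oplus_inf_le _ _ _)
  have h6 : inf (odot x (neg y)) (nmul k (odot y (neg x))) = zero := by
    rw [inf_comm]
    exact nmul_inf_eq_zero (prelinearity y x) k
  rw [nmul_inf_eq_zero h6 m, oplus_zero] at h5
  exact hP.prop.2 (hPI.mem_of_le h5 (hPI.oplus_mem hp hq))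

theorem IdealQuotient.le_total {P : Set A} (hP : IsIdeal P)
    (h : ∀ x y, odot x (neg y) ∈ P ∨ odot y (neg x) ∈ P) (x y : IdealQuotient P hP) :
    le x y ∨ le y x := by
  obtain ⟨x, rfl⟩ := IdealQuotient.mk_surjective P hP x
  obtain ⟨y, rfl⟩ := IdealQuotient.mk_surjective P hP y
  rw [le_iff_odot_neg, le_iff_odot_neg, ← MVHom.map_neg, ← MVHom.map_neg, ← MVHom.map_odot,
    ← MVHom.map_odot, IdealQuotient.mk_eq_zero_iff, IdealQuotient.mk_eq_zero_iff]
  exact h x y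

end Ideal

/-! ### Scalar multiplication and quotients of DMV-algebras. -/

section DMV

variable {A : Type u} [DMVAlgebra A]

theorem zero_qmul (x : A) : qmul zero x = zero := by
  have h := odot_neg_qmul zero zero x
  rwa [odot_neg_self, odot_neg_self] at h

theorem qmul_zero (q : UnitQ) : qmul q (zero : A) = zero := by
  have h := qmul_odot_neg q (zero : A) zero
  rwa [odot_neg_self, odot_neg_self] at h

theorem qmul_le_qmul {r q : UnitQ} (h : r.1 ≤ q.1) (x : A) : le (qmul r x) (qmul q x) := by
  have h0 : odot r (neg q) = zero := Subtype.ext (by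
    rw [coe_odot, coe_neg, coe_zero]
    exact max_eq_left (by linarith))
  rw [le_iff_odot_neg, ← odot_neg_qmul, h0, zero_qmul]

theorem qmul_le (q : UnitQ) (x : A) : le (qmul q x) x := by
  have h := qmul_le_qmul (r := q) (q := 1) q.2.2 x
  rwa [one_qmul] at h

/-- The axioms only mention differences. Reading `r` as `s ⊙ q*` makes `r x` the difference of `s x`
and `q x`, and additivity becomes cancellation. -/
theorem qmul_add {r q s : UnitQ} (h : r.1 + q.1 = s.1) (x : A) :
    odot (qmul r x) (qmul q x) = zero ∧ oplus (qmul r x) (qmul q x) = qmul s x := by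
  have h0 : r = odot s (neg q) := Subtype.ext (by
    have := r.2.1
    rw [coe_odot, coe_neg, max_eq_right] <;> linarith)
  have h1 : le (qmul q x) (qmul s x) := qmul_le_qmul (by have := r.2.1; linarith) x
  rw [h0, odot_neg_qmul]
  refine ⟨?_, odot_neg_oplus_cancel h1⟩
  rw [odot_assoc, odot_comm (neg _), odot_neg_self, odot_zero]

/-- Ideals of the MV-reduct are already compatible with scalars: `q` commutes with differences and
`q x ≤ x`. -/
instance (I : Set A) (hI : IsIdeal I) : DMVAlgebra (IdealQuotient I hI) where
  qmul q := Quotient.map (qmul q) (fun x y h => by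
    change odot _ _ ∈ I ∧ odot _ _ ∈ I
    rw [← qmul_odot_neg, ← qmul_odot_neg]
    exact ⟨hI.mem_of_le (qmul_le _ _) h.1, hI.mem_of_le (qmul_le _ _) h.2⟩)
  qmul_odot_neg := by
    rintro q ⟨x⟩ ⟨y⟩
    exact congrArg (Quotient.mk _) (qmul_odot_neg q x y)
  odot_neg_qmul := by
    rintro q r ⟨x⟩
    exact congrArg (Quotient.mk _) (odot_neg_qmul q r x)
  qmul_qmul := by
    rintro q r ⟨x⟩
    exact congrArg (Quotient.mk _) (qmul_qmul q r x)
  one_qmul := by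
    rintro ⟨x⟩
    exact congrArg (Quotient.mk _) (one_qmul x)

/-- The projection to the quotient of a DMV-algebra by an ideal. -/
def IdealQuotient.dmk (I : Set A) (hI : IsIdeal I) : DMVHom A (IdealQuotient I hI) where
  toMVHom := IdealQuotient.mk I hI
  map_qmul _ _ := rfl

end DMV

/-! ### The ordered group of a linearly ordered MV-algebra -/

section Middle

variable {A : Type u} [MVAlgebra A]

/-- The middle term of the good sequence of `a + b + c`. -/
def middle (a b c : A) : A := oplus (odot a b) (odot (oplus a b) c)

/-- Both sides equal `(a ⊕ b) ⊙ b* ⊙ (b ⊕ c)`, since `a = (a ⊕ b) ⊙ b*` and `c = b* ⊙ (b ⊕ c)` when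
nothing is truncated. -/
theorem oplus_odot_rotate {a b c : A} (ha : le a (neg b)) (hc : le c (neg b)) :
    odot (oplus a b) c = odot a (oplus b c) := by
  have h1 : odot (neg b) (oplus b c) = c := by
    rw [odot_comm, oplus_comm]
    exact oplus_odot_neg_cancel hc
  have h2 : odot (oplus a b) (neg b) = a := oplus_odot_neg_cancel ha
  conv_lhs => rw [← h1]
  rw [← odot_assoc, h2]

/-- Adding `(a ⊕ b)*` gives `c` on either side, and both sides are below `a ⊕ b`, so cancellation
applies. -/
theorem oplus_odot_mixed {a b c : A} (ha : le a (neg b)) (hc : le (neg b) c) :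
    odot (oplus a b) c = oplus a (odot b c) := by
  have h1 : oplus (neg b) (odot b c) = c := by
    rw [odot_comm]
    have h := hc
    rwa [le, sup, MVAlgebra.neg_neg] at h
  have h2 : le (odot b c) b := odot_le_left _ _
  have h3 : le (neg (oplus a b)) c := by
    rw [neg_oplus]
    exact le_trans (odot_le_right _ _) hc
  refine oplus_right_cancel (z := neg (oplus a b)) ?_ ?_ ?_
  · rw [MVAlgebra.neg_neg]
    exact odot_le_left _ _
  · rw [MVAlgebra.neg_neg]
    exact oplus_le_oplus (le_refl a) h2
  · have h4 : oplus (odot (oplus a b) c) (neg (oplus a b)) = c := by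
      have h := h3
      rw [le, sup, MVAlgebra.neg_neg] at h
      rw [oplus_comm, odot_comm]
      exact h
    have h5 : oplus a (neg (oplus a b)) = neg b := by
      rw [neg_oplus, odot_comm]
      exact ha
    rw [h4, oplus_comm a, oplus_assoc, h5, oplus_comm, h1]

theorem middle_swap (a b c : A) : middle a b c = middle b a c := by
  rw [middle, middle, odot_comm a, oplus_comm a]

/-- This is the content of associativity in the group of a chain. The cases compare `a` and `c` with
`b*`; when both are above, negation reduces to the case where both are below. -/
theorem middle_reverse (htot : ∀ x y : A, le x y ∨ le y x) (a b c : A) :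
    middle a b c = middle c b a := by
  have hz : ∀ {x y : A}, le x (neg y) → odot x y = zero := fun h => by
    rw [le_iff_odot_neg, MVAlgebra.neg_neg] at h
    exact h
  have ho : ∀ {x y : A}, le (neg y) x → oplus x y = one := fun h => by
    rw [le_iff_neg_oplus, MVAlgebra.neg_neg, oplus_comm] at h
    exact h
  have hmix : ∀ {a b c : A}, le a (neg b) → le (neg b) c → middle a b c = middle c b a := by
    intro a b c ha hc
    rw [middle, middle, hz ha, ho hc, zero_oplus, one_odot, oplus_odot_mixed ha hc, oplus_comm,
      odot_comm b]
  rcases htot a (neg b) with ha | ha <;> rcases htot c (neg b) with hc | hc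
  · rw [middle, middle, hz ha, hz hc, zero_oplus, zero_oplus, oplus_odot_rotate ha hc,
      odot_comm (oplus c b), oplus_comm b]
  · exact hmix ha hc
  · exact (hmix hc ha).symm
  · have ha' := neg_le_neg ha
    have hc' := neg_le_neg hc
    rw [middle, middle, ho ha, ho hc, one_odot, one_odot]
    refine neg_injective ?_
    rw [neg_oplus, neg_oplus, neg_odot, neg_odot, oplus_odot_rotate ha' hc',
      odot_comm (oplus (neg c) _), oplus_comm (neg b)]

theorem odot_eq_zero_of_oplus_ne_one (htot : ∀ x y : A, le x y ∨ le y x) {a b : A}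
    (h : oplus a b ≠ one) : odot a b = zero := by
  rcases htot a (neg b) with h1 | h1
  · rw [le_iff_odot_neg, MVAlgebra.neg_neg] at h1
    exact h1
  · rw [le_iff_neg_oplus, MVAlgebra.neg_neg, oplus_comm] at h1
    exact absurd h1 h

end Middle

/-- Linearly ordered nontrivial MV-algebras. -/
class MVChain (A : Type u) extends MVAlgebra A where
  total : ∀ x y : A, le x y ∨ le y x
  zero_ne_one : (zero : A) ≠ one

/-- The group of a linearly ordered MV-algebra: integers with a fractional part in the algebra. -/
@[ext]
structure ChainGroup (A : Type u) [MVChain A] : Type u where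
  int : ℤ
  frac : A
  frac_ne : frac ≠ one

namespace ChainGroup

variable {A : Type u} [MVChain A]

theorem odot_ne_one {a : A} (h : a ≠ one) (b : A) : odot a b ≠ one := fun h1 => by
  have h2 := odot_le_left a b
  rw [h1] at h2
  exact h (le_antisymm (le_one a) h2)

open Classical in
/-- The element with integer part `k` plus `a`, where `a` may be `1`. -/
noncomputable def carry (k : ℤ) (a : A) : ChainGroup A :=
  if h : a = one then ⟨k + 1, zero, MVChain.zero_ne_one⟩ else ⟨k, a, h⟩

theorem carry_of_ne (k : ℤ) {a : A} (h : a ≠ one) : carry k a = ⟨k, a, h⟩ := dif_neg h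

theorem carry_one (k : ℤ) : carry k (one : A) = ⟨k + 1, zero, MVChain.zero_ne_one⟩ := dif_pos rfl

theorem carry_int_frac (p : ChainGroup A) : carry p.int p.frac = p := carry_of_ne _ p.frac_ne

open Classical in
/-- `k + a + b` -/
noncomputable def addAux (k : ℤ) (a b : A) : ChainGroup A :=
  if oplus a b = one then carry (k + 1) (odot a b) else carry k (oplus a b)

theorem addAux_of_eq (k : ℤ) {a b : A} (h : oplus a b = one) :
    addAux k a b = carry (k + 1) (odot a b) := if_pos h

theorem addAux_of_ne (k : ℤ) {a b : A} (h : oplus a b ≠ one) :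
    addAux k a b = carry k (oplus a b) := if_neg h

theorem addAux_comm (k : ℤ) (a b : A) : addAux k a b = addAux k b a := by
  rw [addAux, addAux, oplus_comm, odot_comm]

noncomputable instance : Add (ChainGroup A) := ⟨fun p q => addAux (p.int + q.int) p.frac q.frac⟩

theorem add_def (p q : ChainGroup A) : p + q = addAux (p.int + q.int) p.frac q.frac := rfl

/-- Addition is defined on normalised pairs; this lets it be computed also when a fractional part
equals `1`. -/
theorem carry_add_carry (k l : ℤ) (a b : A) : carry k a + carry l b = addAux (k + l) a b := by
  by_cases ha : a = one
  · subst ha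
    rw [addAux_of_eq _ (one_oplus b), carry_one, one_odot]
    by_cases hb : b = one
    · subst hb
      rw [carry_one, carry_one, add_def, addAux_of_ne, oplus_zero, carry_of_ne _ MVChain.zero_ne_one]
      · ext
        · change k + 1 + (l + 1) = k + l + 1 + 1
          ring
        · rfl
      · rw [oplus_zero]
        exact MVChain.zero_ne_one
    · rw [carry_of_ne _ hb, add_def, addAux_of_ne, carry_of_ne _ hb]
      · simp only [zero_oplus, carry_of_ne _ hb]
        ext
        · change k + 1 + l = k + l + 1
          ring
        · rfl
      · simp only [zero_oplus]
        exact hb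
  · by_cases hb : b = one
    · subst hb
      rw [addAux_of_eq _ (oplus_one a), carry_one, odot_one, carry_of_ne _ ha, add_def,
        addAux_of_ne]
      · simp only [oplus_zero, carry_of_ne _ ha]
        ext
        · change k + (l + 1) = k + l + 1
          ring
        · rfl
      · simp only [oplus_zero]
        exact ha
    · rw [carry_of_ne _ ha, carry_of_ne _ hb]
      rfl

-- The sum `a + b + c` is recorded by the good sequence `a ⊕ b ⊕ c`, `middle a b c`, `a ⊙ b ⊙ c`:
-- leading ones go to the integer part and the first other entry is the fraction.
open Classical in
theorem addAux_add_carry (k l : ℤ) (a b c : A) : addAux k a b + carry l c =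
    if oplus (oplus a b) c ≠ one then carry (k + l) (oplus (oplus a b) c)
    else if middle a b c ≠ one then carry (k + l + 1) (middle a b c)
    else carry (k + l + 2) (odot (odot a b) c) := by
  by_cases h : oplus a b = one
  · have hM : middle a b c = oplus (odot a b) c := by rw [middle, h, one_odot]
    rw [addAux_of_eq _ h, carry_add_carry, h, one_oplus, if_neg (not_not.2 rfl), hM]
    by_cases h1 : oplus (odot a b) c = one
    · rw [addAux_of_eq _ h1, if_neg (not_not.2 h1)]
      congr 1
      ring
    · rw [addAux_of_ne _ h1, if_pos h1]
      congr 1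
      ring
  · have h0 := odot_eq_zero_of_oplus_ne_one MVChain.total h
    have hM : middle a b c = odot (oplus a b) c := by rw [middle, h0, zero_oplus]
    rw [addAux_of_ne _ h, carry_add_carry, hM, if_pos (odot_ne_one h c)]
    by_cases h1 : oplus (oplus a b) c = one
    · rw [addAux_of_eq _ h1, if_neg (not_not.2 h1)]
    · rw [addAux_of_ne _ h1, if_pos h1]

noncomputable instance : Zero (ChainGroup A) := ⟨⟨0, zero, MVChain.zero_ne_one⟩⟩

theorem zero_def : (0 : ChainGroup A) = ⟨0, zero, MVChain.zero_ne_one⟩ := rfl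

noncomputable instance : Neg (ChainGroup A) := ⟨fun p => carry (-p.int - 1) (neg p.frac)⟩

theorem neg_def (p : ChainGroup A) : -p = carry (-p.int - 1) (neg p.frac) := rfl

theorem add_comm_aux (p q : ChainGroup A) : p + q = q + p := by
  rw [add_def, add_def, addAux_comm, add_comm p.int]

noncomputable instance : AddCommGroup (ChainGroup A) where
  add_assoc p q r := by
    -- After this rotation both bracketings have the shape of `addAux_add_carry`, and it remains to
    -- see that the three entries of the good sequence are symmetric.
    rw [add_comm_aux p (q + r), add_def p, add_def q]
    conv_lhs => rw [← carry_int_frac r]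
    conv_rhs => rw [← carry_int_frac p]
    rw [addAux_add_carry, addAux_add_carry]
    have h1 : middle q.frac r.frac p.frac = middle p.frac q.frac r.frac := by
      rw [middle_swap, middle_reverse MVChain.total]
    have h2 : oplus (oplus q.frac r.frac) p.frac = oplus (oplus p.frac q.frac) r.frac := by
      rw [oplus_comm, oplus_assoc]
    have h3 : odot (odot q.frac r.frac) p.frac = odot (odot p.frac q.frac) r.frac := by
      rw [odot_comm, odot_assoc]
    have h4 : q.int + r.int + p.int = p.int + q.int + r.int := by ring
    rw [h1, h2, h3, h4]
  zero_add p := by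
    rw [add_def, zero_def, addAux_of_ne]
    · simp only [zero_oplus, zero_add]
      exact carry_int_frac p
    · simp only [zero_oplus]
      exact p.frac_ne
  add_zero p := by
    rw [add_def, zero_def, addAux_of_ne]
    · simp only [oplus_zero, add_zero]
      exact carry_int_frac p
    · simp only [oplus_zero]
      exact p.frac_ne
  add_comm := add_comm_aux
  neg_add_cancel p := by
    rw [neg_def]
    conv_lhs => rw [← carry_int_frac p]
    rw [carry_add_carry, carry_int_frac, addAux_of_eq _ (neg_oplus_self _), odot_comm,
      odot_neg_self, carry_of_ne _ MVChain.zero_ne_one]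
    ext
    · change -p.int - 1 + p.int + 1 = 0
      ring
    · rfl
  nsmul := nsmulRec
  zsmul := zsmulRec

theorem int_carry_nonneg {k : ℤ} (hk : 0 ≤ k) (a : A) : 0 ≤ (carry k a).int := by
  by_cases h : a = one
  · subst h
    rw [carry_one]
    exact add_nonneg hk zero_le_one
  · rw [carry_of_ne _ h]
    exact hk

theorem int_addAux_nonneg {k : ℤ} (hk : 0 ≤ k) (a b : A) : 0 ≤ (addAux k a b).int := by
  by_cases h : oplus a b = one
  · rw [addAux_of_eq _ h]
    exact int_carry_nonneg (add_nonneg hk zero_le_one) _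
  · rw [addAux_of_ne _ h]
    exact int_carry_nonneg hk _

theorem int_neg_of_frac_ne {p : ChainGroup A} (h : p.frac ≠ zero) : (-p).int = -p.int - 1 := by
  rw [neg_def, carry_of_ne]
  intro h1
  refine h (neg_injective ?_)
  rw [h1, neg_zero]

theorem int_neg_of_frac_eq {p : ChainGroup A} (h : p.frac = zero) : (-p).int = -p.int := by
  rw [neg_def, h, neg_zero, carry_one]
  change -p.int - 1 + 1 = -p.int
  ring

/-- The cone of elements with nonnegative integer part. -/
noncomputable def cone (A : Type u) [MVChain A] : AddGroupCone (ChainGroup A) where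
  carrier := {p | 0 ≤ p.int}
  add_mem' := fun {_ _} hp hq => int_addAux_nonneg (add_nonneg hp hq) _ _
  zero_mem' := _root_.le_refl (0 : ℤ)
  eq_zero_of_mem_of_neg_mem' := by
    intro p hp hn
    change 0 ≤ p.int at hp
    change 0 ≤ (-p).int at hn
    by_cases h : p.frac = zero
    · rw [int_neg_of_frac_eq h] at hn
      ext
      · change p.int = 0
        omega
      · exact h
    · rw [int_neg_of_frac_ne h] at hn
      omega

theorem mem_cone {p : ChainGroup A} : p ∈ cone A ↔ 0 ≤ p.int := Iff.rfl

instance : HasMemOrNegMem (cone A) where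
  mem_or_neg_mem p := by
    rw [mem_cone, mem_cone]
    by_cases h : p.frac = zero
    · rw [int_neg_of_frac_eq h]
      omega
    · rw [int_neg_of_frac_ne h]
      omega

open Classical in
noncomputable instance : LinearOrder (ChainGroup A) := LinearOrder.mkOfAddGroupCone (cone A)

instance : IsOrderedAddMonoid (ChainGroup A) := IsOrderedAddMonoid.mkOfCone (cone A)

theorem nonneg_iff {p : ChainGroup A} : 0 ≤ p ↔ 0 ≤ p.int := by
  change p - 0 ∈ cone A ↔ _
  rw [sub_zero, mem_cone]

/-- The embedding of a linearly ordered MV-algebra in its group. -/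
noncomputable def of (a : A) : ChainGroup A := carry 0 a

theorem of_zero : of (zero : A) = 0 := carry_of_ne _ MVChain.zero_ne_one

theorem of_nonneg (a : A) : 0 ≤ of a := nonneg_iff.2 (int_carry_nonneg (_root_.le_refl 0) a)

theorem of_injective : Function.Injective (of : A → ChainGroup A) := by
  intro a b h
  by_cases ha : a = one <;> by_cases hb : b = one
  · rw [ha, hb]
  · rw [of, of, ha, carry_one, carry_of_ne _ hb] at h
    exact absurd (congrArg int h) (by norm_num)
  · rw [of, of, hb, carry_one, carry_of_ne _ ha] at h
    exact absurd (congrArg int h) (by norm_num)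
  · rw [of, of, carry_of_ne _ ha, carry_of_ne _ hb] at h
    exact congrArg frac h

theorem of_oplus_of_odot {a b : A} (h : odot a b = zero) : of (oplus a b) = of a + of b := by
  rw [of, of, of, carry_add_carry]
  by_cases h1 : oplus a b = one
  · rw [addAux_of_eq _ h1, h, h1, carry_one, carry_of_ne _ MVChain.zero_ne_one]
    rfl
  · rw [addAux_of_ne _ h1]
    rfl

theorem of_neg (a : A) : of (neg a) = of one - of a := by
  have h := of_oplus_of_odot (odot_neg_self a)
  rw [oplus_neg_self] at h
  rw [h, add_sub_cancel_left]

theorem of_oplus (a b : A) : of (oplus a b) = min (of one) (of a + of b) := by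
  by_cases h : odot a b = zero
  · have h1 := of_nonneg (neg (oplus a b))
    rw [of_neg, sub_nonneg] at h1
    rw [← of_oplus_of_odot h, min_eq_right h1]
  -- In a chain, `a ⊙ b ≠ 0` forces `a ⊕ b = 1`, and the true sum then exceeds the unit by `a ⊙ b`.
  · have h1 : oplus a b = one := by
      by_contra h1
      exact h (odot_eq_zero_of_oplus_ne_one MVChain.total h1)
    have h2 : of a + of b = of one + of (odot a b) := by
      rw [of, of, of, of, carry_add_carry, carry_add_carry, addAux_of_eq _ h1,
        addAux_of_eq _ (one_oplus _), one_odot]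
    rw [h1, h2, min_eq_left (le_add_of_nonneg_right (of_nonneg _))]

end ChainGroup

/-- Embedding of a linearly ordered MV-algebra in the unit interval of an ordered vector space. -/
structure IntervalEmbedding (A : Type u) [MVAlgebra A] (V : Type v) [AddCommGroup V]
    [LinearOrder V] (e : V) where
  toFun : A → V
  injective : Function.Injective toFun
  map_zero : toFun zero = 0
  map_neg : ∀ a, toFun (neg a) = e - toFun a
  map_oplus : ∀ a b, toFun (oplus a b) = min e (toFun a + toFun b)
  map_add : ∀ a b, odot a b = zero → toFun (oplus a b) = toFun a + toFun b
  nonneg : ∀ a, 0 ≤ toFun a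

/-! ### Chains as parts of intervals in rational vector spaces. -/

namespace IntervalEmbedding

/-- The embedding of a chain in the divisible hull of its group. -/
noncomputable def ofChain (A : Type u) [MVChain A] :
    IntervalEmbedding A (DivisibleHull (ChainGroup A)) (DivisibleHull.coe (ChainGroup.of one)) where
  toFun a := DivisibleHull.coe (ChainGroup.of a)
  injective _ _ h := ChainGroup.of_injective (DivisibleHull.coe_injective h)
  map_zero := by
    rw [ChainGroup.of_zero]
    exact _root_.map_zero (DivisibleHull.coeAddMonoidHom _)
  map_neg a := by
    rw [ChainGroup.of_neg]
    exact _root_.map_sub (DivisibleHull.coeAddMonoidHom _) _ _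
  map_oplus a b := by
    rw [ChainGroup.of_oplus, ← DivisibleHull.coe_add]
    exact (DivisibleHull.coeOrderAddMonoidHom (ChainGroup A)).monotone'.map_min
  map_add a b h := by
    rw [ChainGroup.of_oplus_of_odot h, DivisibleHull.coe_add]
  nonneg a := by
    rw [← _root_.map_zero (DivisibleHull.coeAddMonoidHom (ChainGroup A))]
    exact (DivisibleHull.coeOrderAddMonoidHom (ChainGroup A)).monotone' (ChainGroup.of_nonneg a)

variable {A : Type u} {V : Type v} [AddCommGroup V] [LinearOrder V] {e : V}

theorem map_one [MVAlgebra A] (j : IntervalEmbedding A V e) : j.toFun one = e := by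
  rw [one, j.map_neg, j.map_zero, sub_zero]

theorem le_unit [MVAlgebra A] [IsOrderedAddMonoid V] (j : IntervalEmbedding A V e) (a : A) :
    j.toFun a ≤ e := by
  have h := j.nonneg (neg a)
  rwa [j.map_neg, sub_nonneg] at h

theorem map_qmul_nat [DMVAlgebra A] (j : IntervalEmbedding A V e) (q : UnitQ) (x : A) (k : ℕ) :
    ∀ s : UnitQ, (k : ℚ) * q.1 = s.1 → j.toFun (qmul s x) = k • j.toFun (qmul q x) := by
  induction k with
  | zero =>
    intro s hs
    have : s = zero := Subtype.ext (by rw [coe_zero, ← hs]; simp)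
    rw [this, zero_qmul, j.map_zero, zero_smul]
  | succ k ih =>
    intro s hs
    push_cast at hs
    have hq := q.2.1
    have hk : (0 : ℚ) ≤ k * q.1 := mul_nonneg (Nat.cast_nonneg k) hq
    let r : UnitQ := ⟨k * q.1, hk, by have := s.2.2; linarith⟩
    have h := qmul_add (r := r) (q := q) (s := s) (by rw [← hs]; ring) x
    rw [← h.2, j.map_add _ _ h.1, ih r rfl, succ_nsmul]

/-- An embedding of the MV-reduct respects scalars automatically: `x` and `q x` are integer
multiples of `(1/d) x`, where `d` is the denominator of `q`, and multiples without overflow are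
preserved. -/
theorem map_qmul [DMVAlgebra A] [Module ℚ V] (j : IntervalEmbedding A V e) (q : UnitQ) (x : A) :
    j.toFun (qmul q x) = q.1 • j.toFun x := by
  have hd : (0 : ℚ) < q.1.den := by exact_mod_cast q.1.den_pos
  have hd1 : (1 : ℚ) ≤ q.1.den := by exact_mod_cast q.1.den_pos
  have hnum : ((q.1.num.toNat : ℕ) : ℚ) = q.1.num := by
    exact_mod_cast Int.toNat_of_nonneg (Rat.num_nonneg.2 q.2.1)
  have hq : q.1 = (q.1.num.toNat : ℚ) / q.1.den := by rw [hnum, Rat.num_div_den]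
  let r : UnitQ := ⟨1 / q.1.den, div_nonneg zero_le_one hd.le, (div_le_one hd).2 hd1⟩
  have h1 := j.map_qmul_nat r x q.1.den 1 (mul_div_cancel₀ 1 hd.ne')
  have h2 := j.map_qmul_nat r x q.1.num.toNat q (by
    conv_rhs => rw [hq]
    change (q.1.num.toNat : ℚ) * (1 / q.1.den) = _
    ring)
  rw [one_qmul] at h1
  rw [h1, h2, ← Nat.cast_smul_eq_nsmul ℚ, ← Nat.cast_smul_eq_nsmul ℚ, smul_smul,
    hnum, Rat.mul_den_eq_num]

end IntervalEmbedding

/-! ### Positive functionals on finite sets of positive vectors -/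

section Functional

variable {V : Type u} [AddCommGroup V] [LinearOrder V] [IsOrderedAddMonoid V] [Module ℚ V]
  [IsStrictOrderedModule ℚ V]

/-- A finite system of strict homogeneous linear inequalities over `ℚ` that has a solution in an
ordered vector space has a solution in `ℚ`. -/
theorem exists_rat_solution (n : ℕ) : ∀ (x : Fin n → V) (F : Finset (Fin n → ℚ)),
    (∀ c ∈ F, 0 < ∑ i, c i • x i) → ∃ v : Fin n → ℚ, ∀ c ∈ F, 0 < ∑ i, c i * v i := by
  classical
  induction n with
  | zero =>
    intro x F hF
    refine ⟨0, fun c hc => ?_⟩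
    have h := hF c hc
    rw [Finset.univ_eq_empty, Finset.sum_empty] at h
    exact absurd h (lt_irrefl _)
  | succ n ih =>
    intro x F hF
    let tl : (Fin (n + 1) → ℚ) → Fin n → ℚ := fun c i => c i.succ
    have hF' : ∀ c ∈ F, 0 < c 0 • x 0 + ∑ i, tl c i • x i.succ := by
      intro c hc
      have h := hF c hc
      rwa [Fin.sum_univ_succ] at h
    -- Fourier–Motzkin elimination of the first unknown: keep the inequalities without it, and
    -- combine each one with a positive leading coefficient with each one with a negative leading
    -- coefficient so that it cancels.
    let F₀ := (F.filter fun c => c 0 = 0).image tl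
    let F₁ := (F.filter fun c => 0 < c 0) ×ˢ (F.filter fun c => c 0 < 0)
    let G := F₀ ∪ F₁.image fun p i => p.1 0 * p.2 i.succ - p.2 0 * p.1 i.succ
    obtain ⟨v, hv⟩ := ih (fun i => x i.succ) G (by
      intro c hc
      rcases Finset.mem_union.1 hc with h | h
      · obtain ⟨d, hd, rfl⟩ := Finset.mem_image.1 h
        have h1 := hF' d (Finset.mem_filter.1 hd).1
        rwa [(Finset.mem_filter.1 hd).2, zero_smul, zero_add] at h1
      · obtain ⟨⟨p, m⟩, hd, rfl⟩ := Finset.mem_image.1 h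
        obtain ⟨hp, hm⟩ := Finset.mem_product.1 hd
        obtain ⟨hp, hp0⟩ := Finset.mem_filter.1 hp
        obtain ⟨hm, hm0⟩ := Finset.mem_filter.1 hm
        have h1 := smul_pos hp0 (hF' m hm)
        have h2 := smul_pos (neg_pos.2 hm0) (hF' p hp)
        have h3 := add_pos h1 h2
        refine lt_of_lt_of_eq h3 ?_
        simp only [sub_smul, Finset.sum_sub_distrib, mul_smul, ← Finset.smul_sum, smul_add,
          neg_smul, tl]
        rw [smul_comm (p 0) (m 0)]
        abel)
    -- The bound that `c` puts on the first unknown: a lower bound if `c 0 > 0`, an upper one if `c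
    -- 0 < 0`. The combined inequalities say that every lower bound is below every upper bound.
    let b : (Fin (n + 1) → ℚ) → ℚ := fun c => -(∑ i, tl c i * v i) / c 0
    obtain ⟨t, ht, ht'⟩ := Order.exists_between_finsets ((F.filter fun c => 0 < c 0).image b)
      ((F.filter fun c => c 0 < 0).image b) (by
        intro y hy z hz
        obtain ⟨p, hp, rfl⟩ := Finset.mem_image.1 hy
        obtain ⟨m, hm, rfl⟩ := Finset.mem_image.1 hz
        have h := hv _ (Finset.mem_union_right _ (Finset.mem_image_of_mem _
          (Finset.mk_mem_product hp hm)))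
        have hp0 := (Finset.mem_filter.1 hp).2
        have hm0 := (Finset.mem_filter.1 hm).2
        simp only [sub_mul, Finset.sum_sub_distrib, mul_assoc, ← Finset.mul_sum] at h
        change -(∑ i, p i.succ * v i) / p 0 < -(∑ i, m i.succ * v i) / m 0
        rw [← neg_div_neg_eq (-(∑ i, m i.succ * v i)), div_lt_div_iff₀ hp0 (neg_pos.2 hm0)]
        linarith)
    refine ⟨Fin.cons t v, fun c hc => ?_⟩
    rw [Fin.sum_univ_succ]
    simp only [Fin.cons_zero, Fin.cons_succ]
    rcases lt_trichotomy (c 0) 0 with h | h | h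
    · have h1 := ht' _ (Finset.mem_image_of_mem b (Finset.mem_filter.2 ⟨hc, h⟩))
      have h2 : c 0 * b c = -(∑ i, tl c i * v i) := mul_div_cancel₀ _ h.ne
      have h3 := mul_lt_mul_of_neg_left h1 h
      rw [h2] at h3
      change 0 < c 0 * t + ∑ i, tl c i * v i
      linarith
    · rw [h, zero_mul, zero_add]
      exact hv _ (Finset.mem_union_left _ (Finset.mem_image_of_mem tl
        (Finset.mem_filter.2 ⟨hc, h⟩)))
    · have h1 := ht _ (Finset.mem_image_of_mem b (Finset.mem_filter.2 ⟨hc, h⟩))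
      have h2 : c 0 * b c = -(∑ i, tl c i * v i) := mul_div_cancel₀ _ h.ne'
      have h3 := mul_lt_mul_of_pos_left h1 h
      rw [h2] at h3
      change 0 < c 0 * t + ∑ i, tl c i * v i
      linarith

/-- On the finite-dimensional span of `F`, positivity of a functional is a finite system of strict
inequalities in its values on a basis. The basis vectors themselves solve the system in `V`, so it
has a rational solution; the functional then extends to `V`. -/
theorem exists_functional_pos (F : Finset V) (hF : ∀ w ∈ F, 0 < w) :
    ∃ φ : V →ₗ[ℚ] ℚ, ∀ w ∈ F, 0 < φ w := by
  classical
  let W := Submodule.span ℚ (F : Set V)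
  let b := Module.finBasis ℚ W
  have hsum : ∀ w : W, ∑ i, b.repr w i • (b i : V) = w := by
    intro w
    have h := congrArg W.subtype (b.sum_repr w)
    simpa only [_root_.map_sum, _root_.map_smul, Submodule.subtype_apply] using h
  have hmem : ∀ w : F, (w : V) ∈ W := fun w => Submodule.subset_span w.2
  obtain ⟨v, hv⟩ := exists_rat_solution _ (fun i => (b i : V))
    (F.attach.image fun w i => b.repr ⟨w.1, hmem w⟩ i) (by
      intro c hc
      obtain ⟨w, -, rfl⟩ := Finset.mem_image.1 hc
      rw [hsum]
      exact hF _ w.2)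
  obtain ⟨φ, hφ⟩ := (b.constr ℚ v).exists_extend
  refine ⟨φ, fun w hw => ?_⟩
  have h := hv _ (Finset.mem_image_of_mem _ (Finset.mem_attach F ⟨w, hw⟩))
  have h1 : φ w = b.constr ℚ v ⟨w, Submodule.subset_span hw⟩ := by
    rw [← hφ]
    rfl
  rw [h1, Module.Basis.constr_apply_fintype]
  simpa using h

end Functional

/-! ### Completeness with respect to the unit interval -/

noncomputable instance : DMVAlgebra UnitR where
  qmul := qscale
  qmul_odot_neg q x y := by
    refine Subtype.ext ?_
    have hq : (0 : ℝ) ≤ q.1 := Rat.cast_nonneg.2 q.2.1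
    change (q.1 : ℝ) * (odot x (neg y)).1 = (odot (qscale q x) (neg (qscale q y))).1
    rw [coe_odot, coe_odot, coe_neg, coe_neg, mul_max_of_nonneg _ _ hq]
    change _ = max 0 ((q.1 : ℝ) * x.1 + (1 - (q.1 : ℝ) * y.1) - 1)
    congr 1 <;> ring
  odot_neg_qmul r q x := by
    refine Subtype.ext ?_
    change ((odot r (neg q)).1 : ℝ) * x.1 = (odot (qscale r x) (neg (qscale q x))).1
    rw [coe_odot, coe_odot, coe_neg, coe_neg]
    change _ = max 0 ((r.1 : ℝ) * x.1 + (1 - (q.1 : ℝ) * x.1) - 1)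
    push_cast
    rw [max_mul_of_nonneg _ _ x.2.1]
    congr 1 <;> ring
  qmul_qmul r q x := by
    refine Subtype.ext ?_
    change (r.1 : ℝ) * ((q.1 : ℝ) * x.1) = ((r.1 * q.1 : ℚ) : ℝ) * x.1
    push_cast
    ring
  one_qmul x := by
    refine Subtype.ext ?_
    change ((1 : ℚ) : ℝ) * x.1 = x.1
    rw [Rat.cast_one, one_mul]

theorem coe_qmul (q : UnitQ) (x : UnitR) : (qmul q x).1 = (q.1 : ℝ) * x.1 := rfl

/-- The value of a term in the unit interval `[0, e]` of an ordered vector space. -/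
def DMVTerm.val {n : ℕ} {V : Type v} [AddCommGroup V] [LinearOrder V] [Module ℚ V] (e : V)
    (x : Fin n → V) : DMVTerm n → V
  | .var i => x i
  | .zero => 0
  | .neg s => e - s.val e x
  | .oplus s t => min e (s.val e x + t.val e x)
  | .qmul q s => q.1 • s.val e x

/-- MV-terms as DMV-terms. -/
def MVTerm.toDMV {n : ℕ} : MVTerm n → DMVTerm n
  | .var i => .var i
  | .zero => .zero
  | .neg s => .neg s.toDMV
  | .oplus s t => .oplus s.toDMV t.toDMV

theorem MVTerm.eval_toDMV {n : ℕ} {A : Type u} [DMVAlgebra A] (g : Fin n → A) (s : MVTerm n) :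
    s.toDMV.eval g = s.eval g := by
  induction s with
  | var i => rfl
  | zero => rfl
  | neg s ih => exact congrArg MVAlgebra.neg ih
  | oplus s t ih ih' => exact congrArg₂ MVAlgebra.oplus ih ih'

section Val

variable {n : ℕ} {V : Type v} [AddCommGroup V] [LinearOrder V] [Module ℚ V] {e : V}

theorem IntervalEmbedding.val_eval {A : Type u} [DMVAlgebra A] (j : IntervalEmbedding A V e)
    (g : Fin n → A) (s : DMVTerm n) : s.val e (fun i => j.toFun (g i)) = j.toFun (s.eval g) := by
  induction s with
  | var i => rfl
  | zero => exact j.map_zero.symm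
  | neg s ih => rw [DMVTerm.val, DMVTerm.eval, ih, j.map_neg]
  | oplus s t ih ih' => rw [DMVTerm.val, DMVTerm.eval, ih, ih', j.map_oplus]
  | qmul q s ih => rw [DMVTerm.val, DMVTerm.eval, ih, j.map_qmul]

theorem IntervalEmbedding.val_toDMV {A : Type u} [MVAlgebra A] (j : IntervalEmbedding A V e)
    (g : Fin n → A) (s : MVTerm n) :
    s.toDMV.val e (fun i => j.toFun (g i)) = j.toFun (s.eval g) := by
  induction s with
  | var i => rfl
  | zero => exact j.map_zero.symm
  | neg s ih => rw [MVTerm.toDMV, DMVTerm.val, MVTerm.eval, ih, j.map_neg]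
  | oplus s t ih ih' => rw [MVTerm.toDMV, DMVTerm.val, MVTerm.eval, ih, ih', j.map_oplus]

variable [IsOrderedAddMonoid V]

/-- A functional that is positive on a suitable finite set of positive vectors commutes with the
evaluation of a term. -/
theorem DMVTerm.exists_tests (x : Fin n → V) (s : DMVTerm n) : ∃ F : Finset V,
    ∀ φ : V →ₗ[ℚ] ℚ, 0 < φ e → (∀ w ∈ F, 0 < w → 0 < φ w) → ∀ v : Fin n → UnitR,
      (∀ i, (v i).1 = ((φ (x i) / φ e : ℚ) : ℝ)) →
        (s.eval v).1 = ((φ (s.val e x) / φ e : ℚ) : ℝ) := by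
  classical
  induction s with
  | var i => exact ⟨∅, fun φ _ _ v hv => hv i⟩
  | zero =>
    refine ⟨∅, fun φ _ _ v _ => ?_⟩
    rw [DMVTerm.eval, DMVTerm.val, coe_zero, _root_.map_zero, zero_div, Rat.cast_zero]
  | neg s ih =>
    obtain ⟨F, hF⟩ := ih
    refine ⟨F, fun φ he hφ v hv => ?_⟩
    rw [DMVTerm.eval, DMVTerm.val, coe_neg, hF φ he hφ v hv, _root_.map_sub, sub_div,
      div_self he.ne', Rat.cast_sub, Rat.cast_one]
  | oplus s t ih ih' =>
    obtain ⟨F, hF⟩ := ih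
    obtain ⟨G, hG⟩ := ih'
    -- Both signs of the difference are tested, so whichever is positive stays positive under `φ`,
    -- and `φ` commutes with this minimum.
    refine ⟨F ∪ G ∪ {e - (s.val e x + t.val e x), s.val e x + t.val e x - e},
      fun φ he hφ v hv => ?_⟩
    have h1 := hφ (e - (s.val e x + t.val e x)) (by simp)
    have h2 := hφ (s.val e x + t.val e x - e) (by simp)
    rw [_root_.map_sub, sub_pos, sub_pos] at h1 h2
    have h3 : φ (min e (s.val e x + t.val e x)) = min (φ e) (φ (s.val e x + t.val e x)) := by
      rcases lt_trichotomy e (s.val e x + t.val e x) with h | h | h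
      · rw [min_eq_left h.le, min_eq_left (h2 h).le]
      · rw [← h, min_self, min_self]
      · rw [min_eq_right h.le, min_eq_right (h1 h).le]
    rw [DMVTerm.eval, DMVTerm.val, coe_oplus, hF φ he (fun w hw => hφ w (by simp [hw])) v hv,
      hG φ he (fun w hw => hφ w (by simp [hw])) v hv, h3, ← min_div_div_right he.le,
      div_self he.ne', _root_.map_add, add_div, Rat.cast_min, Rat.cast_one, Rat.cast_add]
  | qmul q s ih =>
    obtain ⟨F, hF⟩ := ih
    refine ⟨F, fun φ he hφ v hv => ?_⟩
    rw [DMVTerm.eval, DMVTerm.val, coe_qmul, hF φ he hφ v hv, _root_.map_smul, smul_eq_mul,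
      mul_div_assoc, Rat.cast_mul]

theorem DMVTerm.exists_point [IsStrictOrderedModule ℚ V] (he : 0 < e) (x : Fin n → V)
    (hx : ∀ i, 0 ≤ x i ∧ x i ≤ e) {s t : DMVTerm n} (hs : s.val e x = 0) (ht : 0 < t.val e x) :
    ∃ v : Fin n → UnitR, s.eval v = MVAlgebra.zero ∧ t.eval v ≠ MVAlgebra.zero := by
  classical
  obtain ⟨F, hF⟩ := s.exists_tests (e := e) x
  obtain ⟨G, hG⟩ := t.exists_tests (e := e) x
  -- Besides the tests for `s` and `t`, the unit is needed for normalisation, `t.val e x` to keep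
  -- `t` nonzero, and `x i`, `e - x i` to land in the cube.
  let T : Finset V := F ∪ G ∪ {e, t.val e x} ∪ Finset.univ.image x ∪
    Finset.univ.image (fun i => e - x i)
  obtain ⟨φ, hφ⟩ := exists_functional_pos (T.filter fun w => 0 < w)
    (fun w hw => (Finset.mem_filter.1 hw).2)
  have hφ' : ∀ w ∈ T, 0 < w → 0 < φ w := fun w hw h => hφ w (Finset.mem_filter.2 ⟨hw, h⟩)
  have hφ0 : ∀ w ∈ T, 0 ≤ w → 0 ≤ φ w := fun w hw h => by
    rcases h.eq_or_lt with h | h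
    · rw [← h, _root_.map_zero]
    · exact (hφ' w hw h).le
  have he' : 0 < φ e := hφ' e (by simp [T]) he
  have hv0 : ∀ i, 0 ≤ φ (x i) / φ e := fun i =>
    div_nonneg (hφ0 _ (by simp [T]) (hx i).1) he'.le
  have hv1 : ∀ i, φ (x i) / φ e ≤ 1 := fun i => by
    have h := hφ0 (e - x i) (by simp [T]) (sub_nonneg.2 (hx i).2)
    rw [_root_.map_sub, sub_nonneg] at h
    exact (div_le_one he').2 h
  let v : Fin n → UnitR := fun i => ⟨((φ (x i) / φ e : ℚ) : ℝ), by exact_mod_cast hv0 i,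
    by exact_mod_cast hv1 i⟩
  refine ⟨v, Subtype.ext ?_, fun h => ?_⟩
  · rw [hF φ he' (fun w hw => hφ' w (by simp [T, hw])) v (fun _ => rfl), hs, _root_.map_zero,
      zero_div, Rat.cast_zero, coe_zero]
  · have h1 := hG φ he' (fun w hw => hφ' w (by simp [T, hw])) v (fun _ => rfl)
    have h2 : 0 < φ (t.val e x) / φ e := div_pos (hφ' _ (by simp [T]) ht) he'
    rw [h, coe_zero] at h1
    have h3 : (0 : ℚ) = φ (t.val e x) / φ e := by exact_mod_cast h1
    exact h2.ne h3

end Val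

/-! ### Principal ideals of free algebras and zero sets in the cube. -/

theorem IntervalEmbedding.pos {A : Type u} [MVAlgebra A] {V : Type v} [AddCommGroup V]
    [LinearOrder V] {e : V} (j : IntervalEmbedding A V e) {a : A} (ha : a ≠ zero) :
    0 < j.toFun a :=
  lt_of_le_of_ne (j.nonneg a) fun h => ha (j.injective (h.symm.trans j.map_zero.symm))

theorem IdealQuotient.one_ne_zero {A : Type u} [MVAlgebra A] {P : Set A} (hP : IsIdeal P)
    {b : A} (hb : b ∉ P) : (one : IdealQuotient P hP) ≠ zero := fun h =>
  hb (IdealQuotient.mk_eq_zero_iff.1 (le_zero (by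
    rw [← h]
    exact le_one (IdealQuotient.mk P hP b))))

/-- The chain structure on the quotient by a prime ideal. -/
abbrev IdealQuotient.chain {A : Type u} [MVAlgebra A] {P : Set A} (hP : IsIdeal P)
    (htot : ∀ x y, odot x (neg y) ∈ P ∨ odot y (neg x) ∈ P) {b : A} (hb : b ∉ P) :
    MVChain (IdealQuotient P hP) where
  total := IdealQuotient.le_total hP htot
  zero_ne_one := (IdealQuotient.one_ne_zero hP hb).symm

/-- A prime ideal separating `b` from `(a]` gives a counterexample in a chain, which
`DMVTerm.exists_point` moves to the real cube. -/
theorem FreeMV.mem_principalIdeal {n : ℕ} {a b : FreeMV n}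
    (h : ∀ v : Fin n → UnitR, FreeMV.lift v a = zero → FreeMV.lift v b = zero) :
    b ∈ principalIdeal a := by
  by_contra hb
  obtain ⟨P, hP, haP, hbP, htot⟩ := (isIdeal_principalIdeal a).exists_prime hb
  let _ := IdealQuotient.chain hP htot hbP
  let j := IntervalEmbedding.ofChain (IdealQuotient P hP)
  let g : Fin n → IdealQuotient P hP := fun i => IdealQuotient.mk P hP (FreeMV.var i)
  have hg : IdealQuotient.mk P hP = FreeMV.lift g := FreeMV.lift_unique g _ fun _ => rfl
  have ha0 : FreeMV.lift g a = zero := by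
    rw [← hg]
    exact IdealQuotient.mk_eq_zero_iff.2 (haP (mem_principalIdeal_self a))
  have hb0 : FreeMV.lift g b ≠ zero := by
    rw [← hg]
    exact fun h' => hbP (IdealQuotient.mk_eq_zero_iff.1 h')
  obtain ⟨s, rfl⟩ := Quotient.mk_surjective a
  obtain ⟨t, rfl⟩ := Quotient.mk_surjective b
  obtain ⟨v, hv, hv'⟩ := DMVTerm.exists_point (s := s.toDMV) (t := t.toDMV)
    (lt_of_lt_of_eq (j.pos (IdealQuotient.one_ne_zero hP hbP)) j.map_one)
    (fun i => j.toFun (g i)) (fun i => ⟨j.nonneg _, j.le_unit _⟩)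
    (by rw [j.val_toDMV]; exact (congrArg j.toFun ha0).trans j.map_zero)
    (by rw [j.val_toDMV]; exact j.pos hb0)
  rw [MVTerm.eval_toDMV] at hv hv'
  exact hv' (h v hv)

/-- The MV argument carries over: the quotient by a prime ideal of the MV-reduct inherits the
scalars, and its embedding respects them. -/
theorem FreeDMV.mem_principalIdeal {n : ℕ} {a b : FreeDMV n}
    (h : ∀ v : Fin n → UnitR, FreeDMV.lift v a = zero → FreeDMV.lift v b = zero) :
    b ∈ principalIdeal a := by
  by_contra hb
  obtain ⟨P, hP, haP, hbP, htot⟩ := (isIdeal_principalIdeal a).exists_prime hb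
  let _ := IdealQuotient.chain hP htot hbP
  let j := IntervalEmbedding.ofChain (IdealQuotient P hP)
  let g : Fin n → IdealQuotient P hP := fun i => IdealQuotient.mk P hP (FreeDMV.var i)
  have hg : IdealQuotient.dmk P hP = FreeDMV.lift g := FreeDMV.lift_unique g _ fun _ => rfl
  have ha0 : FreeDMV.lift g a = zero := by
    rw [← hg]
    exact IdealQuotient.mk_eq_zero_iff.2 (haP (mem_principalIdeal_self a))
  have hb0 : FreeDMV.lift g b ≠ zero := by
    rw [← hg]
    exact fun h' => hbP (IdealQuotient.mk_eq_zero_iff.1 h')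
  obtain ⟨s, rfl⟩ := Quotient.mk_surjective a
  obtain ⟨t, rfl⟩ := Quotient.mk_surjective b
  obtain ⟨v, hv, hv'⟩ := DMVTerm.exists_point (s := s) (t := t)
    (lt_of_lt_of_eq (j.pos (IdealQuotient.one_ne_zero hP hbP)) j.map_one)
    (fun i => j.toFun (g i)) (fun i => ⟨j.nonneg _, j.le_unit _⟩)
    (by rw [j.val_eval]; exact (congrArg j.toFun ha0).trans j.map_zero)
    (by rw [j.val_eval]; exact j.pos hb0)
  exact hv' (h v hv)

/-! ### Zero sets of DMV-terms are zero sets of MV-terms -/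

/-- Truncation to the unit interval. -/
noncomputable def clamp (y : ℝ) : ℝ := max 0 (min 1 y)

/-- McNaughton's recursion: the truncation of `y + f` is `(clamp y ⊕ f) ⊙ clamp (y + 1)`. The second
factor corrects the first when `y < 0`. -/
theorem clamp_add (y : ℝ) {f : ℝ} (h0 : 0 ≤ f) (h1 : f ≤ 1) :
    clamp (y + f) = max 0 (min 1 (clamp y + f) + clamp (y + 1) - 1) := by
  unfold clamp
  grind

theorem clamp_neg (y : ℝ) : clamp (-y) = 1 - clamp (y + 1) := by
  unfold clamp
  grind

theorem clamp_min (y z : ℝ) : clamp (min y z) = min (clamp y) (clamp z) := by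
  unfold clamp
  grind

/-- Cuts `[0, N]` into slices of height one, so that a bounded function becomes a sum of functions
into `[0,1]`. -/
theorem sum_clamp (y : ℝ) (N : ℕ) :
    ∑ j ∈ Finset.range N, clamp (y - j) = max 0 (min (N : ℝ) y) := by
  induction N with
  | zero =>
    rw [Finset.range_zero, Finset.sum_empty, Nat.cast_zero, max_eq_left (min_le_left _ _)]
  | succ N ih =>
    have hN : (0 : ℝ) ≤ N := Nat.cast_nonneg N
    rw [Finset.sum_range_succ, ih, Nat.cast_succ]
    unfold clamp
    grind

section Definable

variable {n : ℕ}

/-- Functions on the cube given by MV-terms. -/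
def IsMVFun (f : (Fin n → UnitR) → ℝ) : Prop := ∃ s : MVTerm n, ∀ v, f v = (s.eval v).1

/-- Bounded functions on the cube all of whose integer translates truncate to functions given by
MV-terms. -/
structure IsMVGroupFun (h : (Fin n → UnitR) → ℝ) : Prop where
  bounded : ∃ m : ℕ, ∀ v, |h v| ≤ m
  clamp : ∀ k : ℤ, IsMVFun fun v => clamp (h v + k)

theorem IsMVFun.neg {f : (Fin n → UnitR) → ℝ} (hf : IsMVFun f) : IsMVFun fun v => 1 - f v := by
  obtain ⟨s, hs⟩ := hf
  exact ⟨s.neg, fun v => by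
    beta_reduce
    rw [hs, MVTerm.eval, coe_neg]⟩

theorem IsMVFun.oplus {f g : (Fin n → UnitR) → ℝ} (hf : IsMVFun f) (hg : IsMVFun g) :
    IsMVFun fun v => min 1 (f v + g v) := by
  obtain ⟨s, hs⟩ := hf
  obtain ⟨t, ht⟩ := hg
  exact ⟨s.oplus t, fun v => by
    beta_reduce
    rw [hs, ht, MVTerm.eval, coe_oplus]⟩

theorem IsMVFun.nonneg {f : (Fin n → UnitR) → ℝ} (hf : IsMVFun f) (v : Fin n → UnitR) :
    0 ≤ f v := by
  obtain ⟨s, hs⟩ := hf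
  rw [hs]
  exact (s.eval v).2.1

theorem IsMVFun.le_one {f : (Fin n → UnitR) → ℝ} (hf : IsMVFun f) (v : Fin n → UnitR) :
    f v ≤ 1 := by
  obtain ⟨s, hs⟩ := hf
  rw [hs]
  exact (s.eval v).2.2

theorem IsMVFun.odot {f g : (Fin n → UnitR) → ℝ} (hf : IsMVFun f) (hg : IsMVFun g) :
    IsMVFun fun v => max 0 (f v + g v - 1) := by
  obtain ⟨s, hs⟩ := hf
  obtain ⟨t, ht⟩ := hg
  exact ⟨(s.neg.oplus t.neg).neg, fun v => by
    beta_reduce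
    rw [hs, ht]
    exact (coe_odot _ _).symm⟩

theorem IsMVFun.min {f g : (Fin n → UnitR) → ℝ} (hf : IsMVFun f) (hg : IsMVFun g) :
    IsMVFun fun v => min (f v) (g v) := by
  -- The infimum in MV-operations: `f ∧ g = f ⊙ (f* ⊕ g)`.
  have h := hf.odot (hf.neg.oplus hg)
  refine (congrArg IsMVFun (funext fun v => ?_)).mp h
  have h1 := hf.nonneg v
  have h2 := hf.le_one v
  have h3 := hg.nonneg v
  grind

theorem isMVFun_zero : IsMVFun fun _ : Fin n → UnitR => (0 : ℝ) := ⟨.zero, fun _ => rfl⟩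

theorem IsMVGroupFun.congr {f g : (Fin n → UnitR) → ℝ} (hf : IsMVGroupFun f)
    (h : ∀ v, g v = f v) : IsMVGroupFun g := (funext h : g = f) ▸ hf

theorem isMVGroupFun_zero : IsMVGroupFun fun _ : Fin n → UnitR => (0 : ℝ) where
  bounded := ⟨0, fun v => by simp⟩
  clamp k := by
    rcases le_or_gt k 0 with h | h
    · have h' : (k : ℝ) ≤ 0 := by exact_mod_cast h
      refine (congrArg IsMVFun (funext fun v => ?_)).mp isMVFun_zero
      rw [zero_add, MV.clamp, max_eq_left ((min_le_right _ _).trans h')]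
    · have h' : (1 : ℝ) ≤ k := by exact_mod_cast h
      refine (congrArg IsMVFun (funext fun v => ?_)).mp isMVFun_zero.neg
      rw [zero_add, MV.clamp, min_eq_left h', sub_zero, max_eq_right zero_le_one]

theorem IsMVGroupFun.add_int {h : (Fin n → UnitR) → ℝ} (hh : IsMVGroupFun h) (l : ℤ) :
    IsMVGroupFun fun v => h v + l where
  bounded := by
    obtain ⟨m, hm⟩ := hh.bounded
    refine ⟨m + l.natAbs, fun v => ?_⟩
    rw [Nat.cast_add, Nat.cast_natAbs, Int.cast_abs]
    exact (abs_add_le _ _).trans (add_le_add_left (hm v) _)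
  clamp k := by
    refine (congrArg IsMVFun (funext fun v => ?_)).mp (hh.clamp (l + k))
    rw [Int.cast_add, add_assoc]

theorem IsMVGroupFun.add_isMVFun {h f : (Fin n → UnitR) → ℝ} (hh : IsMVGroupFun h)
    (hf : IsMVFun f) : IsMVGroupFun fun v => h v + f v where
  bounded := by
    obtain ⟨m, hm⟩ := hh.bounded
    refine ⟨m + 1, fun v => ?_⟩
    rw [Nat.cast_add, Nat.cast_one]
    refine (abs_add_le _ _).trans (add_le_add (hm v) ?_)
    rw [abs_of_nonneg (hf.nonneg v)]
    exact hf.le_one v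
  clamp k := by
    refine (congrArg IsMVFun (funext fun v => ?_)).mp
      (((hh.clamp k).oplus hf).odot (hh.clamp (k + 1)))
    rw [add_right_comm, clamp_add _ (hf.nonneg v) (hf.le_one v), Int.cast_add, Int.cast_one,
      add_assoc (h v)]

theorem IsMVFun.isMVGroupFun {f : (Fin n → UnitR) → ℝ} (hf : IsMVFun f) : IsMVGroupFun f :=
  (isMVGroupFun_zero.add_isMVFun hf).congr fun _ => (zero_add _).symm

/-- If `|h| ≤ m`, then `h + m` is a sum of `2m` unit slices, each given by an MV-term. They are
added to `g - m` one at a time by `IsMVGroupFun.add_isMVFun`. -/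
theorem IsMVGroupFun.add {g h : (Fin n → UnitR) → ℝ} (hg : IsMVGroupFun g)
    (hh : IsMVGroupFun h) : IsMVGroupFun fun v => g v + h v := by
  obtain ⟨m, hm⟩ := hh.bounded
  have key : ∀ N : ℕ, IsMVGroupFun fun v =>
      g v + ((-m : ℤ) : ℝ) + ∑ j ∈ Finset.range N, MV.clamp (h v + m - j) := by
    intro N
    induction N with
    | zero => exact (hg.add_int (-m)).congr fun v => by rw [Finset.sum_range_zero, add_zero]
    | succ N ih =>
      refine (ih.add_isMVFun (hh.clamp (m - N))).congr fun v => ?_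
      rw [Finset.sum_range_succ, ← add_assoc]
      push_cast
      rw [add_sub_assoc]
  refine (key (2 * m)).congr fun v => ?_
  have h1 := abs_le.1 (hm v)
  rw [sum_clamp, min_eq_right, max_eq_right]
  · push_cast
    ring
  · linarith
  · push_cast
    linarith

theorem IsMVGroupFun.neg {h : (Fin n → UnitR) → ℝ} (hh : IsMVGroupFun h) :
    IsMVGroupFun fun v => -h v where
  bounded := by
    obtain ⟨m, hm⟩ := hh.bounded
    exact ⟨m, fun v => by rw [abs_neg]; exact hm v⟩
  clamp k := by
    refine (congrArg IsMVFun (funext fun v => ?_)).mp (hh.clamp (-k + 1)).neg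
    rw [show -h v + k = -(h v + -k) by ring, clamp_neg]
    push_cast
    rw [add_assoc]

theorem IsMVGroupFun.min {g h : (Fin n → UnitR) → ℝ} (hg : IsMVGroupFun g)
    (hh : IsMVGroupFun h) : IsMVGroupFun fun v => min (g v) (h v) where
  bounded := by
    obtain ⟨m, hm⟩ := hg.bounded
    obtain ⟨k, hk⟩ := hh.bounded
    refine ⟨max m k, fun v => ?_⟩
    rw [Nat.cast_max]
    exact abs_min_le_max_abs_abs.trans (max_le_max (hm v) (hk v))
  clamp k := by
    refine (congrArg IsMVFun (funext fun v => ?_)).mp ((hg.clamp k).min (hh.clamp k))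
    rw [← clamp_min, min_add_add_right]

theorem IsMVGroupFun.nat_mul {h : (Fin n → UnitR) → ℝ} (hh : IsMVGroupFun h) (m : ℕ) :
    IsMVGroupFun fun v => m * h v := by
  induction m with
  | zero => exact isMVGroupFun_zero.congr fun v => by rw [Nat.cast_zero, zero_mul]
  | succ m ih => exact (ih.add hh).congr fun v => by push_cast; ring

/-- Clears denominators along the term. For `⊕` a common multiple turns the truncation at `1` into
one at the integer `N M`; a scalar `q` contributes its denominator to `N` and its numerator as an
integer factor. -/
theorem DMVTerm.exists_nat_mul (t : DMVTerm n) :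
    ∃ N : ℕ, 0 < N ∧ IsMVGroupFun fun v => (N : ℝ) * (t.eval v).1 := by
  induction t with
  | var i =>
    refine ⟨1, one_pos, IsMVFun.isMVGroupFun ⟨.var i, fun v => ?_⟩⟩
    beta_reduce
    rw [Nat.cast_one, one_mul]
    rfl
  | zero => exact ⟨1, one_pos, isMVGroupFun_zero.congr fun v => mul_zero _⟩
  | neg s ih =>
    obtain ⟨N, hN, h⟩ := ih
    refine ⟨N, hN, (h.neg.add_int N).congr fun v => ?_⟩
    rw [DMVTerm.eval, coe_neg, Int.cast_natCast]
    ring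
  | oplus s t ih ih' =>
    obtain ⟨N, hN, h⟩ := ih
    obtain ⟨M, hM, h'⟩ := ih'
    refine ⟨N * M, Nat.mul_pos hN hM, ((isMVGroupFun_zero.add_int (N * M : ℕ)).min
      ((h.nat_mul M).add (h'.nat_mul N))).congr fun v => ?_⟩
    rw [DMVTerm.eval, coe_oplus, mul_min_of_nonneg _ _ (Nat.cast_nonneg _), Int.cast_natCast,
      zero_add, mul_one, Nat.cast_mul]
    congr 1
    ring
  | qmul q s ih =>
    obtain ⟨N, hN, h⟩ := ih
    refine ⟨N * q.1.den, Nat.mul_pos hN q.1.den_pos, (h.nat_mul q.1.num.toNat).congr fun v => ?_⟩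
    have h1 : (q.1.num.toNat : ℚ) = q.1 * q.1.den := by
      rw [Rat.mul_den_eq_num]
      exact_mod_cast Int.toNat_of_nonneg (Rat.num_nonneg.2 q.2.1)
    have h2 : (q.1.num.toNat : ℝ) = (q.1 : ℝ) * q.1.den := by exact_mod_cast h1
    rw [DMVTerm.eval, coe_qmul, h2, Nat.cast_mul]
    ring

/-- Neither multiplying a nonnegative function by `N > 0` nor truncating it at `1` changes its
zeros. -/
theorem DMVTerm.exists_same_zeros (t : DMVTerm n) : ∃ s : MVTerm n,
    ∀ v : Fin n → UnitR, s.eval v = MVAlgebra.zero ↔ t.eval v = MVAlgebra.zero := by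
  obtain ⟨N, hN, h⟩ := t.exists_nat_mul
  obtain ⟨s, hs⟩ := h.clamp 0
  refine ⟨s, fun v => ?_⟩
  have hN' : (0 : ℝ) < N := Nat.cast_pos.2 hN
  have h0 := (t.eval v).2.1
  rw [Subtype.ext_iff, Subtype.ext_iff, coe_zero, ← hs]
  beta_reduce
  rw [Int.cast_zero, add_zero, MV.clamp]
  constructor
  · intro h1
    have h2 : (N : ℝ) * (t.eval v).1 ≤ 0 := by
      by_contra! h3
      exact absurd h1 (lt_max_of_lt_right (lt_min one_pos h3)).ne'
    exact _root_.le_antisymm (nonpos_of_mul_nonpos_right h2 hN') h0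
  · intro h1
    rw [h1, mul_zero, min_eq_right zero_le_one, max_self]

end Definable

theorem lift_freeIncl {n : ℕ} {A : Type u} [DMVAlgebra A] (g : Fin n → A) (b : FreeMV n) :
    FreeDMV.lift g (freeIncl n b) = FreeMV.lift g b :=
  congrFun (congrArg MVHom.toFun (FreeMV.lift_unique g
    ((FreeDMV.lift g).toMVHom.comp (freeIncl n)) fun _ => rfl)) b

/-- Two elements of `DMV_n` with equal zero sets lie in each other's principal ideals. -/
theorem exists_principalIdeal_freeIncl {n : ℕ} (a : FreeDMV n) :
    ∃ b : FreeMV n, principalIdeal a = principalIdeal (freeIncl n b) := by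
  obtain ⟨t, rfl⟩ := Quotient.mk_surjective a
  obtain ⟨s, hs⟩ := t.exists_same_zeros
  refine ⟨Quotient.mk _ s, Set.Subset.antisymm
    ((isIdeal_principalIdeal _).principalIdeal_subset (FreeDMV.mem_principalIdeal fun v hv => ?_))
    ((isIdeal_principalIdeal _).principalIdeal_subset (FreeDMV.mem_principalIdeal fun v hv => ?_))⟩
  · exact (hs v).1 ((lift_freeIncl v _).symm.trans hv)
  · exact (lift_freeIncl v _).trans ((hs v).2 hv)

/-! ### The tensor product with `[0,1] ∩ ℚ` -/

section Factor

variable {A : Type u} {B : Type v} {C : Type w}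

theorem MVHom.eq_of_ker_subset [MVAlgebra A] [MVAlgebra B] [MVAlgebra C] (π : MVHom A B)
    (f : MVHom A C) (h : ∀ x, π x = zero → f x = zero) {x y : A} (hxy : π x = π y) :
    f x = f y :=
  f.eq_iff.2 ⟨h _ (π.eq_iff.1 hxy).1, h _ (π.eq_iff.1 hxy).2⟩

/-- Factorization through a surjective homomorphism. -/
noncomputable def MVHom.factor [MVAlgebra A] [MVAlgebra B] [MVAlgebra C] (π : MVHom A B)
    (hπ : Function.Surjective π) (f : MVHom A C) (h : ∀ x, π x = zero → f x = zero) :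
    MVHom B C where
  toFun b := f (Function.surjInv hπ b)
  map_oplus x y := by
    rw [← f.map_oplus]
    refine π.eq_of_ker_subset f h ?_
    rw [π.map_oplus]
    simp only [Function.surjInv_eq hπ]
  map_neg x := by
    rw [← f.map_neg]
    refine π.eq_of_ker_subset f h ?_
    rw [π.map_neg]
    simp only [Function.surjInv_eq hπ]
  map_zero := by
    rw [← f.map_zero]
    refine π.eq_of_ker_subset f h ?_
    rw [π.map_zero, Function.surjInv_eq hπ]

theorem MVHom.factor_apply [MVAlgebra A] [MVAlgebra B] [MVAlgebra C] (π : MVHom A B)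
    (hπ : Function.Surjective π) (f : MVHom A C) (h : ∀ x, π x = zero → f x = zero) (x : A) :
    π.factor hπ f h (π x) = f x :=
  π.eq_of_ker_subset f h (Function.surjInv_eq hπ _)

/-- Factorization of DMV-homomorphisms through a surjective homomorphism. -/
noncomputable def DMVHom.factor [DMVAlgebra A] [DMVAlgebra B] [DMVAlgebra C] (π : DMVHom A B)
    (hπ : Function.Surjective π) (f : DMVHom A C) (h : ∀ x, π x = zero → f x = zero) :
    DMVHom B C where
  toMVHom := π.toMVHom.factor hπ f.toMVHom h
  map_qmul q b := by
    obtain ⟨x, rfl⟩ := hπ b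
    rw [← π.map_qmul]
    exact (MVHom.factor_apply _ hπ _ h _).trans ((f.map_qmul q x).trans
      (congrArg (qmul q) (MVHom.factor_apply _ hπ _ h x).symm))

theorem DMVHom.factor_apply [DMVAlgebra A] [DMVAlgebra B] [DMVAlgebra C] (π : DMVHom A B)
    (hπ : Function.Surjective π) (f : DMVHom A C) (h : ∀ x, π x = zero → f x = zero) (x : A) :
    π.factor hπ f h (π x) = f x :=
  MVHom.factor_apply _ hπ _ h x

theorem DMVHom.factor_factor [DMVAlgebra A] [DMVAlgebra B] [DMVAlgebra C] (π : DMVHom A B)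
    (hπ : Function.Surjective π) (f : DMVHom A C) (hf : Function.Surjective f)
    (h : ∀ x, π x = zero → f x = zero) (h' : ∀ x, f x = zero → π x = zero) :
    (f.factor hf π h').comp (π.factor hπ f h) = DMVHom.id B := by
  refine DMVHom.ext (funext fun b => ?_)
  obtain ⟨x, rfl⟩ := hπ b
  exact (congrArg (f.factor hf π h').toFun (DMVHom.factor_apply π hπ f h x)).trans
    (DMVHom.factor_apply f hf π h' x)

end Factor

/-! ### Bimorphisms into `[0,1]` and homomorphisms of `A`. -/

section Bimorphisms

variable {A : Type u} [MVAlgebra A]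

theorem odot_eq_zero_iff {x y : UnitR} : odot x y = zero ↔ x.1 + y.1 ≤ 1 := by
  rw [Subtype.ext_iff, coe_odot, coe_zero, max_eq_left_iff, sub_nonpos]

/-- The bimorphism `(q, a) ↦ q φ(a)`. -/
noncomputable def MVHom.bimorphism (φ : MVHom A UnitR) : Bimorphism UnitQ A UnitR where
  toFun q a := qmul q (φ a)
  map_one_one := by
    refine Subtype.ext ?_
    rw [φ.map_one, coe_qmul, coe_one, coe_one, Rat.cast_one, one_mul]
  map_zero_left a := zero_qmul _
  map_zero_right q := by rw [φ.map_zero, qmul_zero]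
  map_sup_left p q a := by
    refine Subtype.ext ?_
    rw [coe_qmul, coe_sup, coe_sup, coe_qmul, coe_qmul, Rat.cast_max,
      max_mul_of_nonneg _ _ (φ a).2.1]
  map_inf_left p q a := by
    refine Subtype.ext ?_
    rw [coe_qmul, coe_inf, coe_inf, coe_qmul, coe_qmul, Rat.cast_min,
      min_mul_of_nonneg _ _ (φ a).2.1]
  map_sup_right q a b := by
    refine Subtype.ext ?_
    rw [φ.map_sup, coe_qmul, coe_sup, coe_sup, coe_qmul, coe_qmul,
      mul_max_of_nonneg _ _ (Rat.cast_nonneg.2 q.2.1)]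
  map_inf_right q a b := by
    refine Subtype.ext ?_
    rw [φ.map_inf, coe_qmul, coe_inf, coe_inf, coe_qmul, coe_qmul,
      mul_min_of_nonneg _ _ (Rat.cast_nonneg.2 q.2.1)]
  odot_left p q a h := by
    have h1 : p.1 + q.1 ≤ 1 := by
      rwa [Subtype.ext_iff, coe_odot, coe_zero, max_eq_left_iff, sub_nonpos] at h
    exact (qmul_add (s := ⟨p.1 + q.1, add_nonneg p.2.1 q.2.1, h1⟩) rfl _).1
  oplus_left p q a h := by
    have h1 : p.1 + q.1 ≤ 1 := by
      rwa [Subtype.ext_iff, coe_odot, coe_zero, max_eq_left_iff, sub_nonpos] at h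
    exact (qmul_add (s := oplus p q) (by rw [coe_oplus, min_eq_right h1]) _).2.symm
  odot_right q a b h := by
    have h1 := congrArg φ h
    rw [φ.map_odot, φ.map_zero] at h1
    refine le_zero ?_
    rw [← h1]
    exact odot_le_odot (qmul_le _ _) (qmul_le _ _)
  oplus_right q a b h := by
    have h1 := congrArg φ h
    rw [φ.map_odot, φ.map_zero, odot_eq_zero_iff] at h1
    have hq : (0 : ℝ) ≤ q.1 := Rat.cast_nonneg.2 q.2.1
    have hq1 : (q.1 : ℝ) ≤ 1 := by exact_mod_cast q.2.2
    have h2 : (q.1 : ℝ) * ((φ a).1 + (φ b).1) ≤ 1 :=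
      mul_le_one₀ hq1 (add_nonneg (φ a).2.1 (φ b).2.1) h1
    refine Subtype.ext ?_
    rw [φ.map_oplus, coe_qmul, coe_oplus, coe_oplus, coe_qmul, coe_qmul, min_eq_right h1,
      ← mul_add, min_eq_right h2]

theorem MVHom.bimorphism_one (φ : MVHom A UnitR) (a : A) : φ.bimorphism.toFun one a = φ a := by
  have h : (one : UnitQ) = 1 := Subtype.ext (by rw [coe_one]; rfl)
  rw [h]
  exact one_qmul _

/-- Replaces a truncated sum by a sum of orthogonal elements, the only sums a bimorphism is required
to preserve. -/
theorem oplus_eq_oplus_inf (x y : A) : oplus x y = oplus x (inf y (neg x)) := by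
  rw [inf_comm, inf_eq_oplus_odot, MVAlgebra.neg_neg]
  have h := inf_oplus_odot_neg (oplus x y) x
  have h1 : inf (oplus x y) x = x := by
    rw [inf_comm, inf_of_le (le_oplus_left x y)]
  rw [h1, odot_comm] at h
  exact h.symm

theorem odot_inf_neg (x y : A) : odot x (inf y (neg x)) = zero := by
  refine le_zero ?_
  rw [← odot_neg_self x]
  exact odot_le_odot (le_refl x) (inf_le_right _ _)

/-- A bimorphism of `[0,1] ∩ ℚ` and `A` restricts to a homomorphism on `1 ⊗ A`. -/
def Bimorphism.hom (β : Bimorphism UnitQ A UnitR) : MVHom A UnitR :=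
  have hneg : ∀ a, β.toFun one (neg a) = neg (β.toFun one a) := fun a => by
    have h1 := β.odot_right one a (neg a) (odot_neg_self a)
    have h2 := β.oplus_right one a (neg a) (odot_neg_self a)
    rw [oplus_neg_self, β.map_one_one] at h2
    rw [odot_eq_zero_iff] at h1
    refine Subtype.ext ?_
    have h3 := congrArg Subtype.val h2
    rw [coe_one, coe_oplus, min_eq_right h1] at h3
    rw [coe_neg]
    linarith
  { toFun := fun a => β.toFun one a
    map_oplus := fun a b => by
      rw [oplus_eq_oplus_inf a b, β.oplus_right _ _ _ (odot_inf_neg a b), β.map_inf_right, hneg,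
        ← oplus_eq_oplus_inf]
    map_neg := hneg
    map_zero := β.map_zero_right _ }

end Bimorphisms

/-! ### Presentations of `[0,1]_Q ⊗ A`. -/

namespace SSTensor

variable {A : Type u} [MVAlgebra A]

/-- `ι_A` as a homomorphism. -/
def inclHom (A : Type u) [MVAlgebra A] : MVHom A (SSTensor UnitQ A) where
  toFun := incl
  map_oplus a b := ext fun β => β.hom.map_oplus a b
  map_neg a := ext fun β => β.hom.map_neg a
  map_zero := ext fun β => β.hom.map_zero

theorem tmul_eq_qmul (q : UnitQ) (a : A) :
    (tmul q a : SSTensor UnitQ A) = qmul q (incl a) := by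
  have h : (one : UnitQ) = 1 := Subtype.ext (by rw [coe_one]; rfl)
  change _ = qmulFun q (tmul one a)
  rw [qmulFun_tmul, h, mul_one]

/-- Evaluation at a homomorphism. -/
noncomputable def evalDMV (φ : MVHom A UnitR) : DMVHom (SSTensor UnitQ A) UnitR where
  toMVHom := evalHom φ.bimorphism
  map_qmul _ _ := rfl

theorem evalDMV_incl (φ : MVHom A UnitR) (a : A) : evalDMV φ (incl a) = φ a :=
  φ.bimorphism_one a

/-- Every `φ : A → [0,1]` factors through `ι_A`, and these `φ` separate points. -/
theorem incl_injective (hA : Semisimple A) : Function.Injective (incl : A → SSTensor UnitQ A) := by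
  intro a b h
  refine hA a b fun φ => ?_
  rw [← evalDMV_incl, h, evalDMV_incl]

/-- The presentation of `([0,1] ∩ ℚ) ⊗ A` obtained from a presentation of `A`. -/
noncomputable def presentation {n : ℕ} (π : MVHom (FreeMV n) A) :
    DMVHom (FreeDMV n) (SSTensor UnitQ A) :=
  FreeDMV.lift fun i => incl (π (FreeMV.var i))

theorem presentation_freeIncl {n : ℕ} (π : MVHom (FreeMV n) A) (x : FreeMV n) :
    presentation π (freeIncl n x) = incl (π x) := by
  rw [presentation, lift_freeIncl]
  exact (congrFun (congrArg MVHom.toFun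
    (FreeMV.lift_unique _ ((inclHom A).comp π) fun _ => rfl)) x).symm

theorem presentation_surjective {n : ℕ} {π : MVHom (FreeMV n) A} (hπ : Function.Surjective π) :
    Function.Surjective (presentation π) := by
  intro F
  induction F using SSTensor.induction with
  | ht q a =>
    obtain ⟨x, rfl⟩ := hπ a
    exact ⟨qmul q (freeIncl n x), by
      rw [(presentation π).map_qmul, presentation_freeIncl, tmul_eq_qmul]⟩
  | h0 => exact ⟨zero, (presentation π).map_zero⟩
  | hn F ih =>
    obtain ⟨x, rfl⟩ := ih
    exact ⟨neg x, (presentation π).map_neg x⟩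
  | ho F G ih ih' =>
    obtain ⟨x, rfl⟩ := ih
    obtain ⟨y, rfl⟩ := ih'
    exact ⟨oplus x y, (presentation π).map_oplus x y⟩

/-- A zero `v` of `a` induces `φ : A → [0,1]`, and evaluating the tensor product at `φ` after the
presentation is evaluation at `v`. So kernel elements vanish on the zero set of `a`, hence lie in
the ideal. -/
theorem presentation_ker {n : ℕ} {a : FreeMV n} {π : MVHom (FreeMV n) A}
    (hπ : Function.Surjective π) (ha : {x | π x = zero} = principalIdeal a) :
    {x | presentation π x = zero} = principalIdeal (freeIncl n a) := by
  refine Set.Subset.antisymm (fun x hx => FreeDMV.mem_principalIdeal fun v hv => ?_)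
    ((isIdeal_ker (presentation π).toMVHom).principalIdeal_subset ?_)
  · rw [lift_freeIncl] at hv
    have hker : ∀ y, π y = zero → FreeMV.lift v y = zero := fun y hy =>
      (isIdeal_ker (FreeMV.lift v)).principalIdeal_subset hv (ha ▸ hy : y ∈ principalIdeal a)
    let φ := π.factor hπ (FreeMV.lift v) hker
    have h : (evalDMV φ).comp (presentation π) = FreeDMV.lift v :=
      FreeDMV.lift_unique v _ fun i => (evalDMV_incl φ _).trans (π.factor_apply hπ _ hker _)
    rw [← h]
    exact (congrArg (evalDMV φ).toFun hx).trans (evalDMV φ).map_zero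
  · have h : π a = zero := (ha ▸ mem_principalIdeal_self a : a ∈ {x | π x = zero})
    change presentation π (freeIncl n a) = zero
    rw [presentation_freeIncl, h]
    exact (inclHom A).map_zero

end SSTensor

/-! ### Finitely presented algebras. -/

theorem FinPresMV.semisimple {A : Type u} [MVAlgebra A] (hA : FinPresMV A) : Semisimple A := by
  obtain ⟨n, a, π, hπ, ha⟩ := hA
  intro x y hxy
  obtain ⟨s, rfl⟩ := hπ x
  obtain ⟨t, rfl⟩ := hπ y
  -- Evaluation at a zero of `a` factors through `A`, so the hypothesis on homomorphisms of `A`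
  -- applies to it.
  have hv : ∀ v : Fin n → UnitR, FreeMV.lift v a = zero → FreeMV.lift v s = FreeMV.lift v t := by
    intro v hv
    have hker : ∀ y, π y = zero → FreeMV.lift v y = zero := fun y hy =>
      (isIdeal_ker (FreeMV.lift v)).principalIdeal_subset hv (ha ▸ hy : y ∈ principalIdeal a)
    have h := hxy (π.factor hπ (FreeMV.lift v) hker)
    rwa [MVHom.factor_apply, MVHom.factor_apply] at h
  have hmem : ∀ z, z ∈ principalIdeal a → π z = zero := fun z hz =>
    (ha ▸ hz : z ∈ {x | π x = zero})
  exact π.eq_iff.2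
    ⟨hmem _ (FreeMV.mem_principalIdeal fun v h => ((FreeMV.lift v).eq_iff.1 (hv v h)).1),
      hmem _ (FreeMV.mem_principalIdeal fun v h => ((FreeMV.lift v).eq_iff.1 (hv v h)).2)⟩

theorem FinPresMV.tensor {A : Type u} [MVAlgebra A] (hA : FinPresMV A) :
    FinPresDMV (SSTensor UnitQ A) := by
  obtain ⟨n, a, π, hπ, ha⟩ := hA
  exact ⟨n, freeIncl n a, SSTensor.presentation π, SSTensor.presentation_surjective hπ,
    SSTensor.presentation_ker hπ ha⟩

/-- Quotients of `MV_n` live in `Type`; lifting makes them objects of `MVCat.{u}`. -/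
instance {A : Type v} [MVAlgebra A] : MVAlgebra (ULift.{u} A) where
  oplus x y := ⟨oplus x.down y.down⟩
  neg x := ⟨neg x.down⟩
  zero := ⟨zero⟩
  oplus_assoc _ _ _ := congrArg ULift.up (oplus_assoc _ _ _)
  oplus_comm _ _ := congrArg ULift.up (oplus_comm _ _)
  oplus_zero _ := congrArg ULift.up (oplus_zero _)
  neg_neg _ := congrArg ULift.up (MVAlgebra.neg_neg _)
  neg_zero_oplus _ := congrArg ULift.up (neg_zero_oplus _)
  luk _ _ := congrArg ULift.up (luk _ _)

/-- The homomorphism to the lifted algebra. -/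
def MVHom.up (A : Type v) [MVAlgebra A] : MVHom A (ULift.{u} A) where
  toFun := ULift.up
  map_oplus _ _ := rfl
  map_neg _ := rfl
  map_zero := rfl

/-- Every principal ideal of `MV_n` is the kernel of a presentation in any universe. -/
theorem exists_presentation {n : ℕ} (b : FreeMV n) :
    ∃ (A : MVCat.{u}) (π : MVHom (FreeMV n) A.carrier),
      Function.Surjective π ∧ {x | π x = zero} = principalIdeal b := by
  have hI := isIdeal_principalIdeal b
  refine ⟨⟨ULift.{u} (IdealQuotient _ hI)⟩, (MVHom.up _).comp (IdealQuotient.mk _ hI), ?_, ?_⟩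
  · exact ULift.up_surjective.comp (IdealQuotient.mk_surjective _ hI)
  · ext x
    rw [← IdealQuotient.mk_eq_zero_iff (hI := hI)]
    exact ULift.up_inj

/-- DMV-algebras with presentations that have the same kernel are isomorphic. -/
noncomputable def DMVCat.isoOfKer {P : Type v} [DMVAlgebra P] {B C : DMVCat.{u}}
    (π : DMVHom P B.carrier) (hπ : Function.Surjective π) (f : DMVHom P C.carrier)
    (hf : Function.Surjective f) (h : {x | π x = zero} = {x | f x = zero}) : B ≅ C where
  hom := π.factor hπ f fun _ hx => h.subset hx
  inv := f.factor hf π fun _ hx => h.superset hx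
  hom_inv_id := DMVHom.factor_factor _ _ _ _ _ _
  inv_hom_id := DMVHom.factor_factor _ _ _ _ _ _

end MV

/-! ### The main theorem. -/

theorem mainTheorem7 :
    (∃ (h₁ : MV.fpMV.{u} ≤ MV.ssMV.{u})
        (h₂ : ∀ A : MV.fpMV.{u}.FullSubcategory,
          MV.fpDMV.{u} (MV.tensorFunctor.obj ((ObjectProperty.ιOfLE h₁).obj A)).obj),
        (MV.tensorFunctorFP.{u} h₁ h₂).Faithful ∧ (MV.tensorFunctorFP.{u} h₁ h₂).EssSurj) ∧
    (∀ (n : ℕ) (a : MV.FreeDMV n), ∃ b : MV.FreeMV n,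
        MV.principalIdeal a = MV.principalIdeal (MV.freeIncl n b)) := by
  refine ⟨⟨fun _ hA => MV.FinPresMV.semisimple hA, fun A => MV.FinPresMV.tensor A.2, ⟨?_⟩, ⟨?_⟩⟩,
    fun _ a => MV.exists_principalIdeal_freeIncl a⟩
  · intro A B f g hfg
    refine ObjectProperty.hom_ext _ (MV.MVHom.ext (funext fun a => ?_))
    -- Evaluated at `1 ⊗ a`, the two tensored maps give `1 ⊗ f(a)` and `1 ⊗ g(a)`.
    have h := congrArg (fun k => MV.DMVHom.toMVHom k.hom (MV.SSTensor.incl a)) hfg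
    exact MV.SSTensor.incl_injective (MV.FinPresMV.semisimple B.2) h
  · rintro ⟨D, n, a, π, hπ, ha⟩
    -- With the kernel of `π` generated by the image of `b ∈ MV_n`, the preimage object is
    -- `MV_n/(b]`: its tensor product and `D` are quotients of `DMV_n` with the same kernel.
    obtain ⟨b, hb⟩ := MV.exists_principalIdeal_freeIncl a
    obtain ⟨A, ρ, hρ, hk⟩ := MV.exists_presentation.{u} b
    exact ⟨⟨A, n, b, ρ, hρ, hk⟩, ⟨ObjectProperty.isoMk _ (MV.DMVCat.isoOfKer
      (B := ⟨MV.SSTensor MV.UnitQ A.carrier⟩) (MV.SSTensor.presentation ρ)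
      (MV.SSTensor.presentation_surjective hρ) π hπ
      (by rw [MV.SSTensor.presentation_ker hρ hk, ha, hb]))⟩⟩
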